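/- **Conventions.** All vector spaces are finite-dimensional, real, and carry the Euclidean topology. Let $\lambda$ be a partition of an integer $n\ge 1$, identified with its Young diagram. For a set $X$, elements of $X^{n}$ are written as fillings of the $n$ boxes of $\lambda$ (boxes listed left to right, top to bottom). A map $T$ from $X^n$ to a vector space satisfies the *$\lambda$-exchange axioms* if (i) $T(v)=0$ whenever $v$ has equal entries in two different boxes of one column, and (ii) for any two columns and any set $B$ of boxes of the right one, $T(v)=\sum_{w}T(w)$, where for each set $A$ of $|B|$ boxes in the left column the sum has one term $w$, obtained from $v$ by interchanging the entries in $A$ with those in $B$, keeping the vertical order. Let $h_\lambda:V^{n}\to\mathbb S_\lambda(V)$ be the universal multilinear map satisfying the $\lambda$-exchange axioms, where $\mathbb S_\lambda(V)$ is the quotient of $V^{\otimes n}$ by the corresponding relations; for linear $L:V\to V'$ let $\mathbb S_\lambda(L)$ be the linear map with $\mathbb S_\lambda(L)(h_\lambda(v))=h_\lambda(L\circ v)$. For $P\subseteq V$ put $$\mathbb S_\lambda(P):=\operatorname{Conv}\big(h_\lambda(P\times\cdots\times P)\big)\subseteq \mathbb S_\lambda(V).$$ A morphism between compact convex sets is a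 map that is the restriction of a linear map of the ambient spaces; a map $P^n\to W$ is multilinear if it is the restriction of a multilinear map of the ambient spaces. A convex body is a compact convex set with non-empty interior. A polytope is the convex hull of a finite set. A spectrahedron is a set $\{x: A+\sum_i x_iB_i\succeq 0\}$ with $A,B_i$ real symmetric matrices; an SDR set (projection of a spectrahedron) is a set $\{x:\exists y,\ A+\sum_i x_iB_i+\sum_j y_jC_j\succeq0\}$ with real symmetric $A,B_i,C_j$. **Theorem.** Let $V$ be a vector space of dimension $m$ and $P\subseteq V$ a compact convex set with $0\in P$. 1. $\mathbb S_\lambda$ is a functor from the category of compact convex sets containing the origin (in arbitrary finite-dimensional real vector spaces) to itself: $\mathbb S_\lambda(P)$ is a compact convex set containing $0$; if a morphism $f:P\to Q$ is the restriction of a linear map $L$, then $\mathbb S_\lambda(L)$ restricts to a morphism $\mathbb S_\lambda(f):\mathbb S_\lambda(P)\to\mathbb S_\lambda(Q)$ that does not depend on the choice of $L$, and identities and compositions are preserved. 2. Let $W$ be any compact convex set (in a finite-dimensional real vector space) and let $T:P^{n}\to W$ be any multilinear map satisfying the $\lambda$-exchange axioms. There is a unique morphism $t:\mathbb S_\lambda(P)\to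 W$ with $t\circ h_\lambda=T$. 3. If $P$ is a convex body, then $\mathbb S_\lambda(P)$ is a convex body in $\mathbb S_\lambda(V)$, and its dimension is the number of semistandard tableaux of shape $\lambda$ with entries in $\{1,\dots,m\}$. If $\lambda$ has more than one row, then $\mathbb S_\lambda(P)=-\mathbb S_\lambda(P)$. 4. If $E$ is the set of extreme points of $P$, then $\mathbb S_\lambda(P)=\operatorname{Conv}(h_\lambda(E^{n}))$. In particular, if $P$ is a polytope then so is $\mathbb S_\lambda(P)$. 5. Let $\nu$ be a finite Borel measure supported on $P$, i.e. $\nu(V\setminus P)=0$ and every neighbourhood of every point of $P$ has positive measure; if $P$ is a convex body, the restriction to $P$ of any Lebesgue (Haar) measure of $V$ is such a measure. For $k\ge 0$ let $Q_k$ be the set of linear functionals $\ell$ on $\mathbb S_\lambda(V)$ such that the symmetric bilinear form $$(a,b)\mapsto\int_{P^{n}}\big(1+\ell(h_\lambda(x))\big)\,a(x)\,b(x)\,d\nu^{n}(x)$$ on the polynomials of degree at most $k$ on $V^{n}$ is positive semidefinite, and let $Q_k^\circ=\{y\in\mathbb S_\lambda(V):\ell(y)\ge-1\text{ for all }\ell\in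 Q_k\}$. Then $Q_{k+1}\subseteq Q_k$, each $Q_k$ is a spectrahedron, each $Q_k^\circ$ is an SDR set, and $\mathbb S_\lambda(P)=\overline{\bigcup_k Q_k^\circ}$, i.e. $\nu$ determines an accurate approximation scheme for $\mathbb S_\lambda(P)$ by projections of spectrahedra. -/

import Mathlib

open MeasureTheory CategoryTheory Topology
open scoped TensorProduct

universe u v w

noncomputable section

namespace ConvexSchur

/-! ### Tableaux of vectors and the exchange axioms -/

/-- The boxes of the Young diagram `μ`; the box `(i, j)` lies in row `i` and column `j`. -/
abbrev Box (μ : YoungDiagram) : Type := {c : ℕ × ℕ // c ∈ μ.cells}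

/-- The box in row `i` of column `j`. -/
def colBox (μ : YoungDiagram) (j : ℕ) (i : Fin (μ.colLen j)) : Box μ :=
  ⟨((i : ℕ), j), (YoungDiagram.mem_cells _).2 (YoungDiagram.mem_iff_lt_colLen.2 i.2)⟩

instance orderEmbFintype (k l : ℕ) : Fintype (Fin k ↪o Fin l) :=
  Fintype.ofInjective (fun f => (f : Fin k → Fin l)) DFunLike.coe_injective

/-- The filling obtained from `v` by interchanging the entries in the boxes `f` of column `j₁`
with the entries in the boxes `g` of column `j₂`. A set of `k` boxes of a column is given by its
increasing enumeration, so the vertical order is kept. -/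
def exchange {μ : YoungDiagram} {X : Type*} {j₁ j₂ k : ℕ} (v : Box μ → X)
    (f : Fin k ↪o Fin (μ.colLen j₁)) (g : Fin k ↪o Fin (μ.colLen j₂)) : Box μ → X :=
  Function.extend (colBox μ j₁ ∘ f) (v ∘ colBox μ j₂ ∘ g)
    (Function.extend (colBox μ j₂ ∘ g) (v ∘ colBox μ j₁ ∘ f) v)

/-- The exchange axioms of shape `μ`: `T` vanishes on fillings with two equal entries in a column,
and, for two columns and a given set of boxes in the right one, `T v` is the sum of `T` over all
fillings obtained from `v` by exchanging these boxes with equally many boxes of the left one. -/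
structure ExchangeAxioms (μ : YoungDiagram) {X E : Type*} [AddCommGroup E]
    (T : (Box μ → X) → E) : Prop where
  alternating : ∀ (v : Box μ → X) (b b' : Box μ), b ≠ b' → b.1.2 = b'.1.2 → v b = v b' → T v = 0
  exchange : ∀ (j₁ j₂ : ℕ), j₁ < j₂ → ∀ (k : ℕ) (g : Fin k ↪o Fin (μ.colLen j₂)) (v : Box μ → X),
    T v = ∑ f : Fin k ↪o Fin (μ.colLen j₁), T (exchange v f g)

/-! ### The Schur functor on vector spaces -/

section Schur

variable (μ : YoungDiagram) (V : Type u) [AddCommGroup V] [Module ℝ V]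

/-- The relations imposed on the tensor power by the exchange axioms. -/
def schurRel : Submodule ℝ (⨂[ℝ] _ : Box μ, V) :=
  Submodule.span ℝ
    ({z | ∃ (v : Box μ → V) (b b' : Box μ), b ≠ b' ∧ b.1.2 = b'.1.2 ∧ v b = v b' ∧
        z = PiTensorProduct.tprod ℝ v} ∪
     {z | ∃ (j₁ j₂ : ℕ), j₁ < j₂ ∧ ∃ (k : ℕ) (g : Fin k ↪o Fin (μ.colLen j₂)) (v : Box μ → V),
        z = PiTensorProduct.tprod ℝ v -
          ∑ f : Fin k ↪o Fin (μ.colLen j₁), PiTensorProduct.tprod ℝ (exchange v f g)})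

/-- The Schur module `𝕊_μ(V)`. -/
abbrev SchurModule : Type u := (⨂[ℝ] _ : Box μ, V) ⧸ schurRel μ V

/-- The Euclidean topology of the Schur module. On a finite-dimensional real vector space the
module topology is the unique Hausdorff vector space topology. -/
instance schurTopology : TopologicalSpace (SchurModule μ V) :=
  moduleTopology ℝ (SchurModule μ V)

instance schurIsModuleTopology : IsModuleTopology ℝ (SchurModule μ V) := ⟨rfl⟩

/-- The universal multilinear map `h_μ`, sending a filling to the class of the tableau. -/
def schurH : MultilinearMap ℝ (fun _ : Box μ => V) (SchurModule μ V) :=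
  (schurRel μ V).mkQ.compMultilinearMap (PiTensorProduct.tprod ℝ)

variable {V}

variable {W : Type v} [AddCommGroup W] [Module ℝ W]

theorem comp_exchange {X Y : Type*} (φ : X → Y) {j₁ j₂ k : ℕ} (v : Box μ → X)
    (f : Fin k ↪o Fin (μ.colLen j₁)) (g : Fin k ↪o Fin (μ.colLen j₂)) :
    (fun c => φ (exchange v f g c)) = exchange (fun c => φ (v c)) f g := by
  funext c
  simp only [exchange, Function.extend_def, Function.comp_apply]
  split_ifs <;> rfl

theorem schurRel_le (L : V →ₗ[ℝ] W) :
    schurRel μ V ≤ (schurRel μ W).comap (PiTensorProduct.map fun _ : Box μ => L) := by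
  refine Submodule.span_le.2 ?_
  rintro z (⟨v, b, b', hb, hc, hv, rfl⟩ | ⟨j₁, j₂, hj, k, g, v, rfl⟩)
  · refine Submodule.subset_span (Or.inl ⟨fun c => L (v c), b, b', hb, hc, by simp [hv], ?_⟩)
    exact PiTensorProduct.map_tprod _ _
  · refine Submodule.subset_span (Or.inr ⟨j₁, j₂, hj, k, g, fun c => L (v c), ?_⟩)
    simp only [map_sub, map_sum, PiTensorProduct.map_tprod, comp_exchange]

/-- The linear map `𝕊_μ(L)`, sending the class of the tableau `v` to the class of `L ∘ v`. -/
def schurMap (L : V →ₗ[ℝ] W) : SchurModule μ V →ₗ[ℝ] SchurModule μ W :=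
  (schurRel μ V).mapQ (schurRel μ W) (PiTensorProduct.map fun _ : Box μ => L) (schurRel_le μ L)

/-- `𝕊_μ(P) = Conv (h_μ (P × ⋯ × P))`. -/
def schurSet (P : Set V) : Set (SchurModule μ V) :=
  convexHull ℝ (schurH μ V '' Set.univ.pi fun _ => P)

theorem schurH_mem {P : Set V} (p : Box μ → P) : schurH μ V (fun c => (p c : V)) ∈ schurSet μ P :=
  subset_convexHull ℝ _ ⟨_, fun c _ => (p c).2, rfl⟩

end Schur

/-! ### The category of compact convex sets containing the origin -/

/-- A map between subsets of vector spaces that is the restriction of a linear map. -/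
def IsLinearRestriction {V : Type v} {W : Type w} [AddCommGroup V] [Module ℝ V]
    [AddCommGroup W] [Module ℝ W] {P : Set V} {Q : Set W} (f : P → Q) : Prop :=
  ∃ L : V →ₗ[ℝ] W, ∀ x : P, (f x : W) = L x

/-- Compact convex sets containing the origin. -/
structure IsCompactConvexZero {V : Type v} [AddCommGroup V] [Module ℝ V] [TopologicalSpace V]
    (P : Set V) : Prop where
  isCompact : IsCompact P
  convex : Convex ℝ P
  zero_mem : (0 : V) ∈ P

/-- A convex body: a full-dimensional compact convex set. -/
structure IsConvexBody {V : Type v} [AddCommGroup V] [Module ℝ V] [TopologicalSpace V]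
    (P : Set V) : Prop where
  isCompact : IsCompact P
  convex : Convex ℝ P
  interior_nonempty : (interior P).Nonempty

/-- A polytope: the convex hull of a finite set. -/
def IsPolytope {V : Type v} [AddCommGroup V] [Module ℝ V] (P : Set V) : Prop :=
  ∃ s : Set V, s.Finite ∧ P = convexHull ℝ s

/-- A compact convex set containing the origin in a finite-dimensional real vector space (with
its Euclidean topology). -/
structure CompactConvex : Type (u + 1) where
  space : Type u
  [addCommGroup : AddCommGroup space]
  [module : Module ℝ space]
  [finite : FiniteDimensional ℝ space]
  [topology : TopologicalSpace space]
  [isModuleTopology : IsModuleTopology ℝ space]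
  carrier : Set space
  isCompactConvexZero : IsCompactConvexZero carrier

attribute [instance] CompactConvex.addCommGroup CompactConvex.module CompactConvex.finite
  CompactConvex.topology CompactConvex.isModuleTopology

namespace CompactConvex

/-- Morphisms are the restrictions of linear maps. -/
@[ext]
structure Hom (P Q : CompactConvex.{u}) : Type u where
  toFun : P.carrier → Q.carrier
  isLinearRestriction : IsLinearRestriction toFun

instance category : Category CompactConvex.{u} where
  Hom := Hom
  id P := ⟨id, LinearMap.id, fun _ => rfl⟩
  comp {P Q R} f g := ⟨g.toFun ∘ f.toFun, by
    obtain ⟨L, hL⟩ := f.isLinearRestriction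
    obtain ⟨M, hM⟩ := g.isLinearRestriction
    exact ⟨M ∘ₗ L, fun x => by simp [hL, hM]⟩⟩

/-- The morphism `f` is the restriction of the linear map `L`. -/
def IsRestrictionOf {P Q : CompactConvex.{u}} (f : P ⟶ Q) (L : P.space →ₗ[ℝ] Q.space) : Prop :=
  ∀ x : P.carrier, (Hom.toFun f x : Q.space) = L x

/-- The set `𝕊_μ(P)` as an object, once it is known to be compact, convex and to contain `0`. -/
def schurObj (μ : YoungDiagram) (P : CompactConvex.{u})
    (h : IsCompactConvexZero (schurSet μ P.carrier)) : CompactConvex.{u} where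
  space := SchurModule μ P.space
  carrier := schurSet μ P.carrier
  isCompactConvexZero := h

end CompactConvex

/-! ### Spectrahedra, their projections, and the approximation scheme -/

/-- A spectrahedron: the solution set of a linear matrix inequality `A + B x ⪰ 0`. -/
def IsSpectrahedron {E : Type v} [AddCommGroup E] [Module ℝ E] (S : Set E) : Prop :=
  ∃ (N : ℕ) (A : Matrix (Fin N) (Fin N) ℝ) (B : E →ₗ[ℝ] Matrix (Fin N) (Fin N) ℝ),
    A.IsSymm ∧ (∀ x, (B x).IsSymm) ∧ S = {x | (A + B x).PosSemidef}

/-- A projection of a spectrahedron (an SDR set). -/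
def IsSDR {E : Type v} [AddCommGroup E] [Module ℝ E] (S : Set E) : Prop :=
  ∃ (N d : ℕ) (A : Matrix (Fin N) (Fin N) ℝ) (B : E →ₗ[ℝ] Matrix (Fin N) (Fin N) ℝ)
    (C : (Fin d → ℝ) →ₗ[ℝ] Matrix (Fin N) (Fin N) ℝ),
    A.IsSymm ∧ (∀ x, (B x).IsSymm) ∧ (∀ y, (C y).IsSymm) ∧
      S = {x | ∃ y, (A + B x + C y).PosSemidef}

/-- The polar `{y | ∀ ℓ ∈ Q, ℓ y ≥ -1}` of a set of functionals. -/
def polar {E : Type v} [AddCommGroup E] [Module ℝ E] (Q : Set (Module.Dual ℝ E)) : Set E :=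
  {y | ∀ ℓ ∈ Q, -1 ≤ ℓ y}

/-- A finite measure supported on `P`: it lives on `P`, and every neighbourhood of every point of
`P` has positive measure. -/
structure IsSupportedOn {V : Type v} [TopologicalSpace V] [MeasurableSpace V] (ν : Measure V)
    (P : Set V) : Prop where
  finite : IsFiniteMeasure ν
  compl_eq_zero : ν Pᶜ = 0
  pos : ∀ x ∈ P, ∀ U ∈ 𝓝 x, 0 < ν U

section Scheme

variable (μ : YoungDiagram) {V : Type u} [AddCommGroup V] [Module ℝ V] [FiniteDimensional ℝ V]

/-- The value at `x` of a polynomial in the coordinates of the vectors in the boxes. -/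
def evalPoly (a : MvPolynomial (Box μ × Fin (Module.finrank ℝ V)) ℝ) (x : Box μ → V) : ℝ :=
  MvPolynomial.eval
    (fun t : Box μ × Fin (Module.finrank ℝ V) => (Module.finBasis ℝ V).repr (x t.1) t.2) a

variable [MeasurableSpace V]

/-- The symmetric bilinear form `∫ (1 + ℓ (h_μ x)) a(x) b(x)` over `P × ⋯ × P` with respect to the
product of copies of `ν`. -/
def momentForm (P : Set V) (ν : Measure V) (ℓ : Module.Dual ℝ (SchurModule μ V))
    (a b : MvPolynomial (Box μ × Fin (Module.finrank ℝ V)) ℝ) : ℝ :=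
  ∫ x in Set.univ.pi (fun _ : Box μ => P),
    (1 + ℓ (schurH μ V x)) * evalPoly μ a x * evalPoly μ b x ∂(Measure.pi fun _ : Box μ => ν)

/-- The set `Q_k` of functionals whose form is positive semidefinite on polynomials of degree at
most `k`. -/
def schemeQ (P : Set V) (ν : Measure V) (k : ℕ) : Set (Module.Dual ℝ (SchurModule μ V)) :=
  {ℓ | ∀ a : MvPolynomial (Box μ × Fin (Module.finrank ℝ V)) ℝ,
    a.totalDegree ≤ k → 0 ≤ momentForm μ P ν ℓ a a}

/-- The polars of the sets `Q_k` form an accurate approximation scheme for `𝕊_μ(P)` by projections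
of spectrahedra. -/
structure IsAccurateScheme (P : Set V) (ν : Measure V) : Prop where
  antitone : Antitone (schemeQ μ P ν)
  spectrahedron : ∀ k, IsSpectrahedron (schemeQ μ P ν k)
  sdr : ∀ k, IsSDR (polar (schemeQ μ P ν k))
  accurate : schurSet μ P = closure (⋃ k, polar (schemeQ μ P ν k))

end Scheme

end ConvexSchur

end

open ConvexSchur

/-!
The set `𝕊_μ(P)` is the convex hull of the image of `P × ⋯ × P` under a multilinear map, so what
happens at points of `P` propagates to the convex, linear and affine hulls of `P` one argument at a
time. For convex `P`, a multilinear map satisfying the exchange axioms on `P` satisfies them on the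
span of `P`: a form vanishing on the diagonal of `P` vanishes at midpoints, hence is alternating.

The dimension is computed by the straightening law. Exchanges express a filling that is not
semistandard through fillings of larger weight, so the semistandard tableaux span. They are
independent because products of column determinants of a generic matrix satisfy the exchange axioms
(Sylvester's identity) and the leading exponent of such a product determines the tableau.

For the approximation scheme, the form attached to a functional `ℓ` is `1 + ℓ(H)` in a basis of
polynomials that is orthonormal for the product measure, so `Q_k` is a spectrahedron. It is cut out
by the rank-one matrices `c cᵀ` with `|c| = 1`, so by the bipolar theorem `Q_k°` is the convex hull
of `0` and their pairings with `H`: the image under a linear map of the positive semidefinite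
matrices of trace at most one. By the Stone-Weierstrass theorem, a functional lies in all the `Q_k`
only if `1 + ℓ ∘ h_μ` is nonnegative on `P × ⋯ × P`, and separation of convex sets gives the limit.
-/

namespace ConvexSchur

/-! ### Convexity in finite-dimensional topological vector spaces -/

theorem continuous_multilinearMap {R ι E : Type*} [CommRing R] [TopologicalSpace R]
    [IsTopologicalRing R] [Finite ι] {V : ι → Type*} [∀ c, AddCommGroup (V c)]
    [∀ c, Module R (V c)] [∀ c, Module.Free R (V c)] [∀ c, Module.Finite R (V c)]
    [∀ c, TopologicalSpace (V c)] [∀ c, IsModuleTopology R (V c)] [AddCommGroup E] [Module R E]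
    [TopologicalSpace E] [ContinuousAdd E] [ContinuousSMul R E] (M : MultilinearMap R V E) :
    Continuous M := by
  classical
  have := Fintype.ofFinite ι
  let b (c : ι) := Module.Free.chooseBasis R (V c)
  have hM : (M : (∀ c, V c) → E) =
      fun v => ∑ r : ∀ c, Module.Free.ChooseBasisIndex R (V c),
        (∏ c, (b c).coord (r c) (v c)) • M fun c => b c (r c) := by
    funext v
    conv_lhs => rw [show v = fun c => ∑ i, (b c).coord i (v c) • b c i from
      funext fun c => ((b c).sum_repr (v c)).symm]
    rw [M.map_sum]
    exact Finset.sum_congr rfl fun r _ => M.map_smul_univ _ _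
  rw [hM]
  refine continuous_finsetSum _ fun r _ => Continuous.smul ?_ continuous_const
  exact continuous_finsetProd _ fun c _ =>
    (IsModuleTopology.continuous_of_linearMap _).comp (continuous_apply c)

theorem t2Space_of_isModuleTopology {R E : Type*} [CommRing R] [TopologicalSpace R]
    [IsTopologicalRing R] [T2Space R] [AddCommGroup E] [Module R E] [Module.Free R E]
    [Module.Finite R E] [TopologicalSpace E] [IsModuleTopology R E] : T2Space E :=
  let b := Module.Free.chooseBasis R E
  .of_injective_continuous b.equivFun.injective
    (IsModuleTopology.continuous_of_linearMap b.equivFun.toLinearMap)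

theorem extremePoints_image_of_injective {E F : Type*} [AddCommGroup E] [Module ℝ E]
    [AddCommGroup F] [Module ℝ F] {A : F →ᵃ[ℝ] E} (hA : Function.Injective A) (s : Set F) :
    (A '' s).extremePoints ℝ = A '' s.extremePoints ℝ := by
  have hseg (x y z : F) : A x ∈ openSegment ℝ (A y) (A z) ↔ x ∈ openSegment ℝ y z := by
    rw [← image_openSegment, hA.mem_set_image]
  ext y
  constructor
  · intro hy
    obtain ⟨x, hx, rfl⟩ := hy.1
    refine ⟨x, mem_extremePoints_iff_left.2 ⟨hx, fun x₁ h₁ x₂ h₂ h => hA ?_⟩, rfl⟩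
    exact (mem_extremePoints_iff_left.1 hy).2 _ ⟨x₁, h₁, rfl⟩ _ ⟨x₂, h₂, rfl⟩ ((hseg ..).2 h)
  · rintro ⟨x, hx, rfl⟩
    refine mem_extremePoints_iff_left.2 ⟨⟨x, hx.1, rfl⟩, ?_⟩
    rintro _ ⟨x₁, h₁, rfl⟩ _ ⟨x₂, h₂, rfl⟩ h
    exact congrArg A ((mem_extremePoints_iff_left.1 hx).2 x₁ h₁ x₂ h₂ ((hseg ..).1 h))

section FiniteDimensional

variable {E : Type u} [AddCommGroup E] [Module ℝ E] [FiniteDimensional ℝ E]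

theorem convexHull_eq_biUnion_image_stdSimplex (s : Set E) :
    convexHull ℝ s = ⋃ n ∈ Set.Iic (Module.finrank ℝ E + 1),
      (fun p : (Fin n → ℝ) × (Fin n → E) => ∑ i, p.1 i • p.2 i) ''
        (stdSimplex ℝ (Fin n) ×ˢ Set.univ.pi fun _ => s) := by
  refine Set.Subset.antisymm (fun x hx => ?_) (Set.iUnion₂_subset fun n _ => ?_)
  · obtain ⟨ι, _, z, w, hz, hind, hw, hw₁, hwx⟩ := eq_pos_convex_span_of_mem_convexHull hx
    have hcard : Fintype.card ι ≤ Module.finrank ℝ E + 1 :=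
      hind.card_le_finrank_succ.trans (Nat.succ_le_succ (Submodule.finrank_le _))
    let e := (Fintype.equivFin ι).symm
    refine Set.mem_iUnion₂.2 ⟨Fintype.card ι, hcard, (w ∘ e, z ∘ e), ⟨⟨fun i => (hw _).le, ?_⟩,
      fun i _ => hz ⟨e i, rfl⟩⟩, ?_⟩
    · exact (e.sum_comp w).trans hw₁
    · exact (e.sum_comp fun i => w i • z i).trans hwx
  · rintro _ ⟨⟨w, z⟩, ⟨hw, hz⟩, rfl⟩
    exact (convex_convexHull ℝ s).sum_mem (fun i _ => hw.1 i) hw.2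
      fun i _ => subset_convexHull ℝ s (hz i trivial)

variable [TopologicalSpace E] [IsTopologicalAddGroup E] [ContinuousSMul ℝ E]

theorem isCompact_convexHull {s : Set E} (hs : IsCompact s) : IsCompact (convexHull ℝ s) := by
  rw [convexHull_eq_biUnion_image_stdSimplex]
  refine (Set.finite_Iic _).isCompact_biUnion fun n _ => ?_
  exact ((isCompact_stdSimplex ℝ _).prod (isCompact_univ_pi fun _ => hs)).image (by fun_prop)

variable [T2Space E]

theorem locallyConvexSpace_of_finiteDimensional : LocallyConvexSpace ℝ E := by
  let e := toEuclidean (E := E)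
  rw [e.toHomeomorph.isInducing.eq_induced]
  exact .induced e.toLinearEquiv.toLinearMap

theorem interior_nonempty_iff_affineSpan_eq_top {s : Set E} (hs : Convex ℝ s) :
    (interior s).Nonempty ↔ affineSpan ℝ s = ⊤ := by
  let e := toEuclidean (E := E)
  have hint : e '' interior s = interior (e '' s) := e.toHomeomorph.image_interior s
  have hspan := e.toLinearEquiv.toAffineEquiv.span_eq_top_iff (s := s)
  rw [← Set.image_nonempty (f := e), hint, hspan]
  exact (hs.linear_image e.toLinearEquiv.toLinearMap).interior_nonempty_iff_affineSpan_eq_top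

theorem exists_dual_ne_zero_forall_le {C : Set E} (hC : Convex ℝ C) (hne : C.Nonempty) {x : E}
    (hx : x ∉ C) : ∃ f : StrongDual ℝ E, f ≠ 0 ∧ ∀ y ∈ C, f y ≤ f x := by
  by_cases hspan : affineSpan ℝ C = ⊤
  · have hint := (interior_nonempty_iff_affineSpan_eq_top hC).2 hspan
    exact geometric_hahn_banach_of_nonempty_interior_point hC (fun h => hx (interior_subset h)) hint
  · obtain ⟨c, hc⟩ := hne
    have hdir : (affineSpan ℝ C).direction < ⊤ := lt_top_iff_ne_top.2 fun h =>
      hspan ((AffineSubspace.direction_eq_top_iff_of_nonempty ⟨c, subset_affineSpan ℝ C hc⟩).1 h)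
    obtain ⟨f, hf, hker⟩ := Submodule.exists_le_ker_of_lt_top _ hdir
    have hconst (y : E) (hy : y ∈ C) : f y = f c := sub_eq_zero.1 <| by
      rw [← map_sub]
      exact hker (AffineSubspace.vsub_mem_direction (subset_affineSpan ℝ C hy)
        (subset_affineSpan ℝ C hc))
    obtain h | h := le_total (f c) (f x)
    · exact ⟨f.toContinuousLinearMap, by simpa using hf, fun y hy => (hconst y hy).trans_le h⟩
    · exact ⟨-f.toContinuousLinearMap, by simpa using hf,
        fun y hy => neg_le_neg (h.trans_eq (hconst y hy).symm)⟩

/- Minkowski's theorem, by induction on the dimension. A point outside the convex hull `C` of the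
extreme points would lie in a hyperplane supporting `C`, hence supporting `P = closure C`
(Krein–Milman), and the induction hypothesis applies to the face that this hyperplane cuts out. -/
theorem subset_convexHull_extremePoints {P : Set E} (hP : IsCompact P) (hconv : Convex ℝ P) :
    P ⊆ convexHull ℝ (P.extremePoints ℝ) := by
  induction hn : Module.finrank ℝ E using Nat.strong_induction_on generalizing E with
  | _ n ih =>
  intro x hx
  by_contra hxC
  have := locallyConvexSpace_of_finiteDimensional (E := E)
  obtain ⟨f, hf, hfC⟩ := exists_dual_ne_zero_forall_le (convex_convexHull ℝ _)
    (convexHull_nonempty_iff.2 (hP.extremePoints_nonempty ⟨x, hx⟩)) hxC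
  have hfP : ∀ y ∈ P, f y ≤ f x := by
    rw [← closure_convexHull_extremePoints hP hconv]
    exact closure_minimal hfC (isClosed_le f.continuous continuous_const)
  let face := f.toExposed P
  have hface : IsExposed ℝ P face := ContinuousLinearMap.toExposed.isExposed
  let K := LinearMap.ker f.toLinearMap
  have hK : Module.finrank ℝ K < n := hn ▸ Submodule.finrank_lt fun h =>
    hf (ContinuousLinearMap.coe_injective (LinearMap.ker_eq_top.1 h))
  let A : K →ᵃ[ℝ] E := AffineMap.const ℝ K x + K.subtype.toAffineMap
  have hA (y : K) : A y = x + y := rfl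
  have hAinj : Function.Injective A := fun y z h => Subtype.ext (add_left_cancel h)
  have himage : A '' (A ⁻¹' face) = face := by
    refine Set.image_preimage_eq_of_subset fun y hy => ⟨⟨y - x, ?_⟩, by simp [hA]⟩
    simpa [K, sub_eq_zero] using (hfP y hy.1).antisymm (hy.2 x hx)
  have hemb : IsClosedEmbedding A := (Homeomorph.addLeft x).isClosedEmbedding.comp
    (Submodule.closed_of_finiteDimensional K).isClosedEmbedding_subtypeVal
  have h₀ := ih _ hK (hemb.isCompact_preimage (hface.isCompact hP))
    ((hface.convex hconv).affine_preimage A) rfl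
    (show (0 : K) ∈ A ⁻¹' face by simpa [hA] using show x ∈ face from ⟨hx, hfP⟩)
  have hxface : x ∈ convexHull ℝ (face.extremePoints ℝ) := by
    rw [← himage, extremePoints_image_of_injective hAinj, ← AffineMap.image_convexHull]
    exact ⟨0, h₀, by simp [hA]⟩
  exact hxC (convexHull_mono hface.isExtreme.extremePoints_subset_extremePoints hxface)

theorem convexHull_extremePoints_eq {P : Set E} (hP : IsCompact P) (hconv : Convex ℝ P) :
    convexHull ℝ (P.extremePoints ℝ) = P :=
  (convexHull_min extremePoints_subset hconv).antisymm (subset_convexHull_extremePoints hP hconv)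

end FiniteDimensional

/-! ### Multilinear maps and convex, linear and affine hulls -/

theorem pi_induction {ι : Type*} [Finite ι] [DecidableEq ι] {X : ι → Type*}
    {A B : ∀ i, Set (X i)} {p : (∀ i, X i) → Prop} (base : ∀ v, (∀ i, v i ∈ A i) → p v)
    (step : ∀ v i, (∀ x ∈ A i, p (Function.update v i x)) →
      ∀ x ∈ B i, p (Function.update v i x)) :
    ∀ v, (∀ i, v i ∈ B i) → p v := by
  have := Fintype.ofFinite ι
  suffices h : ∀ (s : Finset ι) (v : ∀ i, X i), (∀ i ∈ s, v i ∈ B i) → (∀ i ∉ s, v i ∈ A i) → p v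
    from fun v hv => h Finset.univ v (fun i _ => hv i) (by simp)
  intro s
  induction s using Finset.induction_on with
  | empty => exact fun v _ h => base v fun i => h i (Finset.notMem_empty i)
  | insert i s hi ih =>
    intro v hvB hvA
    rw [← Function.update_eq_self i v]
    refine step v i (fun x hx => ih _ (fun d hd => ?_) fun d hd => ?_) _
      (hvB i (Finset.mem_insert_self i s))
    · rw [Function.update_of_ne (ne_of_mem_of_not_mem hd hi)]
      exact hvB d (Finset.mem_insert_of_mem hd)
    · obtain rfl | hdi := eq_or_ne d i
      · rwa [Function.update_self]
      · rw [Function.update_of_ne hdi]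
        exact hvA d (by simp [hdi, hd])

section Multilinear

variable {R ι E : Type*} {V : ι → Type*} [Finite ι]

theorem multilinear_mem_of_mem_convexHull [CommSemiring R] [PartialOrder R]
    [∀ i, AddCommMonoid (V i)] [∀ i, Module R (V i)] [AddCommMonoid E] [Module R E]
    {M : MultilinearMap R V E} {A : ∀ i, Set (V i)} {K : Set E} (hK : Convex R K)
    (h : ∀ v, (∀ i, v i ∈ A i) → M v ∈ K) {v : ∀ i, V i} (hv : ∀ i, v i ∈ convexHull R (A i)) :
    M v ∈ K := by
  classical
  refine pi_induction (p := (M · ∈ K)) h (fun v i hA x hx => ?_) v hv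
  exact convexHull_min (t := M.toLinearMap v i ⁻¹' K) hA (hK.linear_preimage _) hx

theorem multilinear_mem_of_mem_span [CommSemiring R] [∀ i, AddCommMonoid (V i)]
    [∀ i, Module R (V i)] [AddCommMonoid E] [Module R E] {M : MultilinearMap R V E}
    {A : ∀ i, Set (V i)} {K : Submodule R E} (h : ∀ v, (∀ i, v i ∈ A i) → M v ∈ K)
    {v : ∀ i, V i} (hv : ∀ i, v i ∈ Submodule.span R (A i)) : M v ∈ K := by
  classical
  refine pi_induction (p := (M · ∈ K)) (B := fun i => Submodule.span R (A i)) h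
    (fun v i hA x hx => ?_) v hv
  exact Submodule.span_le (p := K.comap (M.toLinearMap v i)).2 hA hx

theorem multilinear_mem_of_mem_affineSpan [CommRing R] [∀ i, AddCommGroup (V i)]
    [∀ i, Module R (V i)] [AddCommGroup E] [Module R E] {M : MultilinearMap R V E}
    {A : ∀ i, Set (V i)} {K : AffineSubspace R E} (h : ∀ v, (∀ i, v i ∈ A i) → M v ∈ K)
    {v : ∀ i, V i} (hv : ∀ i, v i ∈ affineSpan R (A i)) : M v ∈ K := by
  classical
  refine pi_induction (p := (M · ∈ K)) (B := fun i => affineSpan R (A i)) h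
    (fun v i hA x hx => ?_) v hv
  exact affineSpan_le (Q := K.comap (M.toLinearMap v i).toAffineMap).2 hA hx

theorem multilinear_eqOn_span [CommRing R] [∀ i, AddCommGroup (V i)] [∀ i, Module R (V i)]
    [AddCommGroup E] [Module R E] {M M' : MultilinearMap R V E} {A : ∀ i, Set (V i)}
    (h : ∀ v, (∀ i, v i ∈ A i) → M v = M' v) {v : ∀ i, V i}
    (hv : ∀ i, v i ∈ Submodule.span R (A i)) : M v = M' v := by
  have hmem : (M - M') v ∈ (⊥ : Submodule R E) :=
    multilinear_mem_of_mem_span (fun v hv => by simp [h v hv]) hv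
  simpa [sub_eq_zero] using hmem

theorem convexHull_image_pi_convexHull [CommSemiring R] [PartialOrder R] [IsOrderedRing R]
    [∀ i, AddCommMonoid (V i)] [∀ i, Module R (V i)] [AddCommMonoid E] [Module R E]
    (M : MultilinearMap R V E) (A : ∀ i, Set (V i)) :
    convexHull R (M '' Set.univ.pi fun i => convexHull R (A i)) =
      convexHull R (M '' Set.univ.pi A) := by
  refine Set.Subset.antisymm (convexHull_min ?_ (convex_convexHull R _))
    (convexHull_mono (Set.image_mono (Set.pi_mono fun _ _ => subset_convexHull R _)))
  rintro _ ⟨v, hv, rfl⟩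
  exact multilinear_mem_of_mem_convexHull (convex_convexHull R _)
    (fun v hv => subset_convexHull R _ (Set.mem_image_of_mem M fun i _ => hv i))
    fun i => hv i trivial

end Multilinear

section Swap

variable {𝕜 V E : Type*} [Field 𝕜] [LinearOrder 𝕜] [IsStrictOrderedRing 𝕜] [AddCommGroup V]
  [Module 𝕜 V] [AddCommGroup E] [Module 𝕜 E] {A : Set V}

theorem bilinear_eq_neg_flip_of_convex {B : V →ₗ[𝕜] V →ₗ[𝕜] E} (hA : Convex 𝕜 A)
    (hB : ∀ z ∈ A, B z z = 0) {x y : V} (hx : x ∈ A) (hy : y ∈ A) : B x y = -B y x := by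
  have hmid := hB _ (hA.midpoint_mem hx hy)
  simp only [midpoint_eq_smul_add, map_smul, map_add, LinearMap.smul_apply, LinearMap.add_apply,
    hB x hx, hB y hy, zero_add, add_zero] at hmid
  rw [← smul_add] at hmid
  exact eq_neg_of_add_eq_zero_right (by simpa [-smul_add] using hmid)

theorem multilinear_swap_of_convex {ι : Type*} [DecidableEq ι]
    {M : MultilinearMap 𝕜 (fun _ : ι => V) E} (hA : Convex 𝕜 A) {i j : ι} (hij : i ≠ j)
    (hM : ∀ v : ι → V, (∀ c, v c ∈ A) → v i = v j → M v = 0) {v : ι → V} (hv : ∀ c, v c ∈ A) :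
    M (v ∘ Equiv.swap i j) = -M v := by
  let B : V →ₗ[𝕜] V →ₗ[𝕜] E :=
    LinearMap.mk₂ 𝕜 (fun x y => M (Function.update (Function.update v i x) j y))
      (fun x x' y => by simp only [Function.update_comm hij, M.map_update_add])
      (fun r x y => by simp only [Function.update_comm hij, M.map_update_smul])
      (fun x y y' => M.map_update_add _ _ _ _) (fun r x y => M.map_update_smul _ _ _ _)
  have hB (z : V) (hz : z ∈ A) : B z z = 0 := by
    refine hM _ (fun c => ?_) (by simp [Function.update_of_ne hij])
    simp only [Function.update_apply]
    split_ifs <;> simp [hz, hv c]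
  calc M (v ∘ Equiv.swap i j) = B (v j) (v i) := by
        rw [Equiv.comp_swap_eq_update, Function.update_comm hij.symm, LinearMap.mk₂_apply]
    _ = -B (v i) (v j) := bilinear_eq_neg_flip_of_convex hA hB (hv j) (hv i)
    _ = -M v := by simp [B]

end Swap

/-! ### Exchanges as permutations of the boxes -/

section Exchange

variable {μ : YoungDiagram} {X : Type*} {j₁ j₂ k : ℕ}

theorem colBox_injective (j : ℕ) : Function.Injective (colBox μ j) :=
  fun _ _ h => Fin.ext (congrArg (fun c : Box μ => c.1.1) h)

@[simp]
theorem colBox_col (j : ℕ) (i : Fin (μ.colLen j)) : (colBox μ j i).1.2 = j := rfl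

theorem exists_colBox_eq (b : Box μ) : ∃ i, colBox μ b.1.2 i = b :=
  ⟨⟨b.1.1, YoungDiagram.mem_iff_lt_colLen.1 ((YoungDiagram.mem_cells _).1 b.2)⟩, rfl⟩

theorem colBox_ne (h : j₁ ≠ j₂) (a : Fin (μ.colLen j₁)) (b : Fin (μ.colLen j₂)) :
    colBox μ j₁ a ≠ colBox μ j₂ b :=
  fun hab => h (congrArg (fun c : Box μ => c.1.2) hab)

theorem colBox_comp_injective (f : Fin k ↪o Fin (μ.colLen j₁)) :
    Function.Injective (colBox μ j₁ ∘ f) :=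
  (colBox_injective j₁).comp f.injective

variable (v : Box μ → X) (f : Fin k ↪o Fin (μ.colLen j₁)) (g : Fin k ↪o Fin (μ.colLen j₂))

theorem exchange_left (i : Fin k) :
    exchange v f g (colBox μ j₁ (f i)) = v (colBox μ j₂ (g i)) :=
  (colBox_comp_injective f).extend_apply _ _ i

theorem exchange_right (h : j₁ ≠ j₂) (i : Fin k) :
    exchange v f g (colBox μ j₂ (g i)) = v (colBox μ j₁ (f i)) := by
  rw [exchange, Function.extend_apply' _ _ _ fun ⟨a, ha⟩ => colBox_ne h _ _ ha]
  exact (colBox_comp_injective g).extend_apply _ _ i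

theorem exchange_of_ne {c : Box μ} (h₁ : ∀ i, colBox μ j₁ (f i) ≠ c)
    (h₂ : ∀ i, colBox μ j₂ (g i) ≠ c) : exchange v f g c = v c := by
  rw [exchange, Function.extend_apply', Function.extend_apply']
  exacts [not_exists.2 h₂, not_exists.2 h₁]

theorem exchange_involutive (h : j₁ ≠ j₂) :
    Function.Involutive (exchange (id : Box μ → Box μ) f g) := by
  intro c
  by_cases h₁ : ∃ i, colBox μ j₁ (f i) = c
  · obtain ⟨i, rfl⟩ := h₁
    rw [exchange_left, id, exchange_right _ _ _ h, id]
  by_cases h₂ : ∃ i, colBox μ j₂ (g i) = c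
  · obtain ⟨i, rfl⟩ := h₂
    rw [exchange_right _ _ _ h, id, exchange_left, id]
  push Not at h₁ h₂
  rw [exchange_of_ne _ _ _ h₁ h₂, id, exchange_of_ne _ _ _ h₁ h₂, id]

/-- The permutation of the boxes underlying an exchange between two different columns. -/
noncomputable def exchangePerm (h : j₁ ≠ j₂) : Equiv.Perm (Box μ) :=
  (exchange_involutive f g h).toPerm

theorem exchange_eq_comp_exchangePerm (h : j₁ ≠ j₂) :
    exchange v f g = v ∘ exchangePerm f g h :=
  (comp_exchange μ v id f g).symm

end Exchange

/-! ### The universal property -/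

section Universal

variable {μ : YoungDiagram} {V : Type u} [AddCommGroup V] [Module ℝ V]
  {E : Type v} [AddCommGroup E] [Module ℝ E]

theorem schurH_exchangeAxioms : ExchangeAxioms μ (schurH μ V) where
  alternating v b b' hb hc hv :=
    (Submodule.Quotient.mk_eq_zero _).2
      (Submodule.subset_span (Or.inl ⟨v, b, b', hb, hc, hv, rfl⟩))
  exchange j₁ j₂ hj k g v := by
    have hrel : PiTensorProduct.tprod ℝ v - ∑ f : Fin k ↪o Fin (μ.colLen j₁),
        PiTensorProduct.tprod ℝ (exchange v f g) ∈ schurRel μ V :=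
      Submodule.subset_span (Or.inr ⟨j₁, j₂, hj, k, g, v, rfl⟩)
    exact ((Submodule.Quotient.eq _).2 hrel).trans (map_sum (schurRel μ V).mkQ _ _)

theorem span_range_schurH : Submodule.span ℝ (Set.range (schurH μ V)) = ⊤ := by
  have h : Set.range (schurH μ V) =
      (schurRel μ V).mkQ '' Set.range (PiTensorProduct.tprod ℝ (s := fun _ : Box μ => V)) := by
    rw [← Set.range_comp]
    rfl
  rw [h, Submodule.span_image, PiTensorProduct.span_tprod_eq_top, Submodule.map_top,
    Submodule.range_mkQ]

theorem schurModule_hom_ext {s t : SchurModule μ V →ₗ[ℝ] E}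
    (h : ∀ v, s (schurH μ V v) = t (schurH μ V v)) : s = t :=
  LinearMap.ext_on span_range_schurH (Set.forall_mem_range.2 h)

theorem schurRel_le_ker_lift {M : MultilinearMap ℝ (fun _ : Box μ => V) E}
    (hM : ExchangeAxioms μ M) : schurRel μ V ≤ LinearMap.ker (PiTensorProduct.lift M) := by
  refine Submodule.span_le.2 ?_
  rintro z (⟨v, b, b', hb, hc, hv, rfl⟩ | ⟨j₁, j₂, hj, k, g, v, rfl⟩)
  · simpa using hM.alternating v b b' hb hc hv
  · simpa [sub_eq_zero] using hM.exchange j₁ j₂ hj k g v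

/-- The linear map on the Schur module induced by a multilinear map satisfying the exchange
axioms. -/
noncomputable def schurLift (M : MultilinearMap ℝ (fun _ : Box μ => V) E)
    (hM : ExchangeAxioms μ M) : SchurModule μ V →ₗ[ℝ] E :=
  (schurRel μ V).liftQ (PiTensorProduct.lift M) (schurRel_le_ker_lift hM)

@[simp]
theorem schurLift_schurH (M : MultilinearMap ℝ (fun _ : Box μ => V) E) (hM : ExchangeAxioms μ M)
    (v : Box μ → V) : schurLift M hM (schurH μ V v) = M v :=
  PiTensorProduct.lift.tprod v

theorem schurH_swap {b b' : Box μ} (hb : b ≠ b') (hc : b.1.2 = b'.1.2) (v : Box μ → V) :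
    schurH μ V (v ∘ Equiv.swap b b') = -schurH μ V v :=
  multilinear_swap_of_convex convex_univ hb
    (fun v _ hv => schurH_exchangeAxioms.alternating v b b' hb hc hv) fun _ => trivial

section Map

variable {W : Type v} [AddCommGroup W] [Module ℝ W]

@[simp]
theorem schurMap_schurH (L : V →ₗ[ℝ] W) (v : Box μ → V) :
    schurMap μ L (schurH μ V v) = schurH μ W fun c => L (v c) :=
  congrArg (schurRel μ W).mkQ (PiTensorProduct.map_tprod _ v)

theorem schurMap_id : schurMap μ (LinearMap.id : V →ₗ[ℝ] V) = LinearMap.id :=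
  schurModule_hom_ext fun v => by simp

theorem schurMap_comp {U : Type w} [AddCommGroup U] [Module ℝ U] (M : W →ₗ[ℝ] U)
    (L : V →ₗ[ℝ] W) : schurMap μ (M ∘ₗ L) = schurMap μ M ∘ₗ schurMap μ L :=
  schurModule_hom_ext fun v => by simp

end Map

end Universal

/-! ### The set `𝕊_μ(P)` -/

section SchurSet

variable {μ : YoungDiagram} {V : Type u} [AddCommGroup V] [Module ℝ V] {P : Set V}
  {E : Type v} [AddCommGroup E] [Module ℝ E]

theorem schurSet_subset {K : Set (SchurModule μ V)} (hK : Convex ℝ K)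
    (h : ∀ p : Box μ → P, schurH μ V (fun c => (p c : V)) ∈ K) : schurSet μ P ⊆ K := by
  refine convexHull_min ?_ hK
  rintro _ ⟨v, hv, rfl⟩
  exact h fun c => ⟨v c, hv c trivial⟩

theorem eqOn_schurSet {s t : SchurModule μ V →ₗ[ℝ] E}
    (h : ∀ p : Box μ → P, s (schurH μ V fun c => (p c : V)) = t (schurH μ V fun c => (p c : V))) :
    Set.EqOn s t (schurSet μ P) :=
  schurSet_subset (LinearMap.eqLocus s t).convex h

theorem mapsTo_schurSet {s : SchurModule μ V →ₗ[ℝ] E} {K : Set E} (hK : Convex ℝ K)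
    (h : ∀ p : Box μ → P, s (schurH μ V fun c => (p c : V)) ∈ K) :
    Set.MapsTo s (schurSet μ P) K :=
  schurSet_subset (hK.linear_preimage s) h

theorem schurMap_mapsTo {W : Type v} [AddCommGroup W] [Module ℝ W] {L : V →ₗ[ℝ] W} {Q : Set W}
    (h : Set.MapsTo L P Q) : Set.MapsTo (schurMap μ L) (schurSet μ P) (schurSet μ Q) :=
  mapsTo_schurSet (convex_convexHull ℝ _) fun p => by
    rw [schurMap_schurH]
    exact schurH_mem μ fun c => ⟨L (p c), h (p c).2⟩

theorem neg_mem_schurSet (h : 1 < μ.colLen 0) {x : SchurModule μ V} (hx : x ∈ schurSet μ P) :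
    -x ∈ schurSet μ P := by
  refine mapsTo_schurSet (s := -LinearMap.id) (convex_convexHull ℝ _) (fun p => ?_) hx
  have hb : colBox μ 0 ⟨0, by lia⟩ ≠ colBox μ 0 ⟨1, h⟩ := (colBox_injective 0).ne (by simp)
  change -schurH μ V _ ∈ schurSet μ P
  rw [← schurH_swap hb rfl]
  exact schurH_mem μ (p ∘ Equiv.swap _ _)

theorem schurSet_convexHull (A : Set V) :
    schurSet μ (convexHull ℝ A) = convexHull ℝ (schurH μ V '' Set.univ.pi fun _ => A) :=
  convexHull_image_pi_convexHull (schurH μ V) fun _ => A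

theorem isPolytope_schurSet (hP : IsPolytope P) : IsPolytope (schurSet μ P) := by
  obtain ⟨s, hs, rfl⟩ := hP
  exact ⟨_, (Set.Finite.pi fun _ => hs).image _, schurSet_convexHull s⟩

theorem zero_mem_schurSet (hμ : 0 < μ.card) (h0 : 0 ∈ P) : 0 ∈ schurSet μ P := by
  obtain ⟨c, hc⟩ := Finset.card_pos.1 hμ
  have hzero : schurH μ V (fun _ => 0) = 0 := (schurH μ V).map_coord_zero (i := ⟨c, hc⟩) rfl
  exact hzero ▸ schurH_mem μ fun _ => ⟨0, h0⟩

theorem isCompact_schurSet [FiniteDimensional ℝ V] [TopologicalSpace V] [IsModuleTopology ℝ V]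
    (hP : IsCompact P) : IsCompact (schurSet μ P) := by
  have := IsModuleTopology.topologicalAddGroup ℝ (SchurModule μ V)
  exact isCompact_convexHull
    ((isCompact_univ_pi fun _ => hP).image (continuous_multilinearMap (schurH μ V)))

theorem schurSet_extremePoints [FiniteDimensional ℝ V] [TopologicalSpace V] [IsModuleTopology ℝ V]
    (hP : IsCompact P) (hconv : Convex ℝ P) : schurSet μ (P.extremePoints ℝ) = schurSet μ P := by
  have := IsModuleTopology.topologicalAddGroup ℝ V
  have := t2Space_of_isModuleTopology (R := ℝ) (E := V)
  rw [schurSet, ← schurSet_convexHull, convexHull_extremePoints_eq hP hconv]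

end SchurSet

/-! ### Linearization of multilinear maps on a convex set -/

section Linearization

variable {μ : YoungDiagram} {V : Type u} [AddCommGroup V] [Module ℝ V] {P : Set V}
  {E : Type v} [AddCommGroup E] [Module ℝ E] {M : MultilinearMap ℝ (fun _ : Box μ => V) E}
  {v : Box μ → V}

theorem multilinear_eq_zero_of_mem_span (hP : Convex ℝ P)
    (hM : ExchangeAxioms μ fun p : Box μ → P => M fun c => (p c : V))
    (hv : ∀ c, v c ∈ Submodule.span ℝ P) {b b' : Box μ} (hb : b ≠ b') (hc : b.1.2 = b'.1.2)
    (hvb : v b = v b') : M v = 0 := by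
  have hswap (w : Box μ → V) (hw : ∀ c, w c ∈ P) : M (w ∘ Equiv.swap b b') = -M w :=
    multilinear_swap_of_convex hP hb (fun w hw hwb =>
      hM.alternating (fun c => ⟨w c, hw c⟩) b b' hb hc (Subtype.ext hwb)) hw
  have h : M (v ∘ Equiv.swap b b') = -M v :=
    multilinear_eqOn_span (M := M.domDomCongr (Equiv.swap b b')) (M' := -M) hswap hv
  rw [show v ∘ Equiv.swap b b' = v by simp [Equiv.comp_swap_eq_update, hvb]] at h
  have hadd : (2 : ℝ) • M v = 0 := by rw [two_smul, ← eq_neg_iff_add_eq_zero, ← h]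
  exact (smul_eq_zero_iff_right two_ne_zero).1 hadd

theorem multilinear_eq_sum_exchange_of_mem_span
    (hM : ExchangeAxioms μ fun p : Box μ → P => M fun c => (p c : V))
    (hv : ∀ c, v c ∈ Submodule.span ℝ P) {j₁ j₂ k : ℕ} (hj : j₁ < j₂)
    (g : Fin k ↪o Fin (μ.colLen j₂)) :
    M v = ∑ f : Fin k ↪o Fin (μ.colLen j₁), M (exchange v f g) := by
  let N := ∑ f : Fin k ↪o Fin (μ.colLen j₁), M.domDomCongr (exchangePerm f g hj.ne)
  have hN (w : Box μ → V) : N w = ∑ f : Fin k ↪o Fin (μ.colLen j₁), M (exchange w f g) := by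
    simp only [N, sum_apply, exchange_eq_comp_exchangePerm w _ g hj.ne]
    rfl
  rw [← hN]
  refine multilinear_eqOn_span (fun w hw => ?_) hv
  rw [hN]
  simpa only [comp_exchange μ (fun x : P => (x : V))] using
    hM.exchange j₁ j₂ hj k g fun c => ⟨w c, hw c⟩

theorem exchangeAxioms_compLinearMap (hP : Convex ℝ P)
    (hM : ExchangeAxioms μ fun p : Box μ → P => M fun c => (p c : V)) {π : V →ₗ[ℝ] V}
    (hπ : ∀ x, π x ∈ Submodule.span ℝ P) :
    ExchangeAxioms μ (M.compLinearMap fun _ => π) where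
  alternating v b b' hb hc hv :=
    multilinear_eq_zero_of_mem_span (M := M) hP hM (fun c => hπ (v c)) hb hc (congrArg π hv)
  exchange j₁ j₂ hj k g v := by
    simpa only [MultilinearMap.compLinearMap_apply, comp_exchange μ π] using
      multilinear_eq_sum_exchange_of_mem_span hM (fun c => hπ (v c)) hj g

theorem exists_linearMap_schurH_eq (hP : Convex ℝ P)
    (hM : ExchangeAxioms μ fun p : Box μ → P => M fun c => (p c : V)) :
    ∃ L : SchurModule μ V →ₗ[ℝ] E,
      ∀ p : Box μ → P, L (schurH μ V fun c => (p c : V)) = M fun c => (p c : V) := by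
  obtain ⟨π, hπ⟩ := (Submodule.span ℝ P).subtype.exists_leftInverse_of_injective
    (Submodule.ker_subtype _)
  have hπP (x : P) : (π x : V) = x :=
    congrArg Subtype.val (LinearMap.congr_fun hπ ⟨x, Submodule.subset_span x.2⟩)
  refine ⟨schurLift (M.compLinearMap fun _ => (Submodule.span ℝ P).subtype ∘ₗ π)
    (exchangeAxioms_compLinearMap hP hM fun x => (π x).2), fun p => ?_⟩
  simp [hπP]

theorem existsUnique_linearization (hP : Convex ℝ P) {W : Set E} (hW : Convex ℝ W)
    (T : (Box μ → P) → W)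
    (hT : ∃ M : MultilinearMap ℝ (fun _ : Box μ => V) E, ∀ p, (T p : E) = M fun c => (p c : V))
    (hTμ : ExchangeAxioms μ fun p => (T p : E)) :
    ∃! t : schurSet μ P → W, IsLinearRestriction t ∧
      ∀ p : Box μ → P, t ⟨schurH μ V (fun c => (p c : V)), schurH_mem μ p⟩ = T p := by
  obtain ⟨M, hM⟩ := hT
  obtain ⟨L, hL⟩ := exists_linearMap_schurH_eq hP (M := M) (by simpa only [← hM] using hTμ)
  have hLT (p : Box μ → P) : L (schurH μ V fun c => (p c : V)) = T p := (hL p).trans (hM p).symm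
  have hmaps : Set.MapsTo L (schurSet μ P) W := mapsTo_schurSet hW fun p => hLT p ▸ (T p).2
  refine ⟨hmaps.restrict, ⟨⟨L, fun _ => rfl⟩, fun p => Subtype.ext (hLT p)⟩, ?_⟩
  rintro t ⟨⟨L', hL'⟩, ht⟩
  refine funext fun x => Subtype.ext ((hL' x).trans (eqOn_schurSet (fun p => ?_) x.2))
  rw [hLT, ← ht, hL']

end Linearization

/-! ### The Schur functor on compact convex sets -/

namespace CompactConvex

variable {μ : YoungDiagram}

theorem schurMap_eqOn_of_isRestrictionOf {P Q : CompactConvex.{u}} {f : P ⟶ Q}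
    {L L' : P.space →ₗ[ℝ] Q.space} (hL : IsRestrictionOf f L) (hL' : IsRestrictionOf f L') :
    Set.EqOn (schurMap μ L) (schurMap μ L') (schurSet μ P.carrier) :=
  eqOn_schurSet fun p => by simp only [schurMap_schurH, ← hL (p _), ← hL' (p _)]

theorem IsRestrictionOf.mapsTo {P Q : CompactConvex.{u}} {f : P ⟶ Q} {L : P.space →ₗ[ℝ] Q.space}
    (hL : IsRestrictionOf f L) : Set.MapsTo L P.carrier Q.carrier :=
  fun x hx => hL ⟨x, hx⟩ ▸ (Hom.toFun f ⟨x, hx⟩).2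

theorem isRestrictionOf_choose {P Q : CompactConvex.{u}} (f : P ⟶ Q) :
    IsRestrictionOf f (Hom.isLinearRestriction f).choose :=
  (Hom.isLinearRestriction f).choose_spec

theorem isCompactConvexZero_schurSet (hμ : 0 < μ.card) (P : CompactConvex.{u}) :
    IsCompactConvexZero (schurSet μ P.carrier) where
  isCompact := isCompact_schurSet P.isCompactConvexZero.isCompact
  convex := convex_convexHull ℝ _
  zero_mem := zero_mem_schurSet hμ P.isCompactConvexZero.zero_mem

/-- The Schur functor on the category of compact convex sets containing the origin. The image of a
morphism is defined through some linear map it is a restriction of. -/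
noncomputable def schurFunctor (hμ : 0 < μ.card) : CompactConvex.{u} ⥤ CompactConvex.{u} where
  obj P := P.schurObj μ (isCompactConvexZero_schurSet hμ P)
  map f := ⟨(schurMap_mapsTo (isRestrictionOf_choose f).mapsTo).restrict, _, fun _ => rfl⟩
  map_id P := by
    refine Hom.ext (funext fun x => Subtype.ext ?_)
    exact (schurMap_eqOn_of_isRestrictionOf (f := 𝟙 P) (L' := .id)
      (isRestrictionOf_choose _) (fun _ => rfl) x.2).trans (LinearMap.congr_fun schurMap_id x.1)
  map_comp f g := by
    refine Hom.ext (funext fun x => Subtype.ext ?_)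
    have hfg : IsRestrictionOf (f ≫ g)
        ((Hom.isLinearRestriction g).choose ∘ₗ (Hom.isLinearRestriction f).choose) := fun y => by
      rw [LinearMap.comp_apply, ← isRestrictionOf_choose f, ← isRestrictionOf_choose g]
      rfl
    exact (schurMap_eqOn_of_isRestrictionOf (isRestrictionOf_choose _) hfg x.2).trans
      (LinearMap.congr_fun (schurMap_comp _ _) x.1)

theorem schurFunctor_map_isRestrictionOf (hμ : 0 < μ.card) {P Q : CompactConvex.{u}} {f : P ⟶ Q}
    {L : P.space →ₗ[ℝ] Q.space} (hL : IsRestrictionOf f L) :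
    IsRestrictionOf (P := P.schurObj μ (isCompactConvexZero_schurSet hμ P))
      (Q := Q.schurObj μ (isCompactConvexZero_schurSet hμ Q)) ((schurFunctor hμ).map f)
      (schurMap μ L) :=
  fun x => schurMap_eqOn_of_isRestrictionOf (isRestrictionOf_choose f) hL x.2

end CompactConvex

/-! ### Semistandard tableaux span the Schur module -/

theorem sum_mul_comp_sub_of_involutive {ι R : Type*} [Fintype ι] [CommRing R] {σ : Equiv.Perm ι}
    (hσ : Function.Involutive σ) (α β : ι → R) :
    ∑ c, α c * β (σ c) - ∑ c, α c * β c = ∑ c, (α (σ c) - α c) * β c := by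
  rw [← Equiv.sum_comp σ fun c => α c * β (σ c), ← Finset.sum_sub_distrib]
  simp only [hσ _, sub_mul]

theorem val_le_val_of_strictMono {k l : ℕ} {f : Fin k → Fin l} (hf : StrictMono f) (i : Fin k) :
    (i : ℕ) ≤ f i := by
  have hsub : (Finset.Iio i).map ⟨f, hf.injective⟩ ⊆ Finset.Iio (f i) := by
    simpa [Finset.subset_iff] using fun a ha => hf ha
  simpa using Finset.card_le_card hsub

theorem sum_two_pow_lt_of_strictMono {k : ℕ} {a : Fin (k + 1) → ℕ} (ha : StrictMono a) :
    ∑ i, 2 ^ a i < 2 ^ (a (Fin.last k) + 1) := by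
  have hlt : ∀ x ∈ Finset.univ.map ⟨a, ha.injective⟩, x < a (Fin.last k) + 1 := by
    simpa using fun i => Nat.lt_succ_of_le (ha.monotone (Fin.le_last i))
  simpa using Nat.geomSum_lt le_rfl hlt

section Straightening

variable {μ : YoungDiagram} {m : ℕ}

/-- A filling is semistandard if its rows increase weakly and its columns increase strictly. -/
structure IsSemistandard {α : Type*} [Preorder α] (T : Box μ → α) : Prop where
  row : ∀ c c' : Box μ, c.1.1 = c'.1.1 → c.1.2 < c'.1.2 → T c ≤ T c'
  col : ∀ j, StrictMono (T ∘ colBox μ j)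

/-- A statistic that grows when large entries move to columns further right. The base `2` makes an
entry outweigh any set of distinct smaller entries. -/
def colWeight (T : Box μ → Fin m) : ℤ := ∑ c, (c.1.2 : ℤ) * 2 ^ (T c : ℕ)

/-- A statistic that grows when large entries move further down. -/
def rowWeight (T : Box μ → Fin m) : ℤ := ∑ c, (c.1.1 : ℤ) * (T c : ℕ)

theorem rowWeight_lt_rowWeight_swap {T : Box μ → Fin m} {b b' : Box μ} (hb : b.1.1 < b'.1.1)
    (hT : T b' < T b) : rowWeight T < rowWeight (T ∘ Equiv.swap b b') := by
  have hne : b ≠ b' := fun h => hb.ne (congrArg (fun c : Box μ => c.1.1) h)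
  have hsub : rowWeight (T ∘ Equiv.swap b b') - rowWeight T =
      ((b'.1.1 : ℤ) - b.1.1) * ((T b : ℕ) - (T b' : ℕ)) := by
    refine (sum_mul_comp_sub_of_involutive (Equiv.swap_apply_self b b')
      (fun c => (c.1.1 : ℤ)) fun c => ((T c : ℕ) : ℤ)).trans ?_
    rw [Fintype.sum_eq_add b b' hne fun c hc => by
      rw [Equiv.swap_apply_of_ne_of_ne hc.1 hc.2, sub_self, zero_mul],
      Equiv.swap_apply_left, Equiv.swap_apply_right]
    ring
  rw [← sub_pos, hsub]
  exact mul_pos (by lia) (sub_pos.2 (by exact_mod_cast hT))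

theorem colWeight_swap (T : Box μ → Fin m) {b b' : Box μ} (hb : b.1.2 = b'.1.2) :
    colWeight (T ∘ Equiv.swap b b') = colWeight T := by
  refine sub_eq_zero.1 ((sum_mul_comp_sub_of_involutive (Equiv.swap_apply_self b b')
    (fun c => (c.1.2 : ℤ)) fun c => 2 ^ (T c : ℕ)).trans (Finset.sum_eq_zero fun c _ => ?_))
  rw [Equiv.swap_apply_def]
  split_ifs with h h' <;> simp [*]

theorem colWeight_exchange_sub (T : Box μ → Fin m) {j₁ j₂ k : ℕ} (hj : j₁ ≠ j₂)
    (f : Fin k ↪o Fin (μ.colLen j₁)) (g : Fin k ↪o Fin (μ.colLen j₂)) :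
    colWeight (exchange T f g) - colWeight T = ((j₂ : ℤ) - j₁) *
      (∑ i, 2 ^ (T (colBox μ j₁ (f i)) : ℕ) - ∑ i, 2 ^ (T (colBox μ j₂ (g i)) : ℕ)) := by
  let s : Fin k ⊕ Fin k → Box μ := Sum.elim (colBox μ j₁ ∘ f) (colBox μ j₂ ∘ g)
  have hs : Function.Injective s :=
    (colBox_comp_injective f).sumElim (colBox_comp_injective g) fun _ _ => colBox_ne hj _ _
  have hleft (i : Fin k) : exchangePerm f g hj (colBox μ j₁ (f i)) = colBox μ j₂ (g i) :=
    exchange_left id f g i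
  have hright (i : Fin k) : exchangePerm f g hj (colBox μ j₂ (g i)) = colBox μ j₁ (f i) :=
    exchange_right id f g hj i
  have hfix (c : Box μ) (hc : c ∉ Set.range s) : exchangePerm f g hj c = c :=
    exchange_of_ne id f g (fun i hi => hc ⟨Sum.inl i, hi⟩) fun i hi => hc ⟨Sum.inr i, hi⟩
  rw [exchange_eq_comp_exchangePerm T f g hj]
  refine (sum_mul_comp_sub_of_involutive (exchange_involutive f g hj)
    (fun c => (c.1.2 : ℤ)) fun c => 2 ^ (T c : ℕ)).trans ?_
  rw [← Fintype.sum_of_injective s hs _ _ (fun c hc => ?_) fun _ => rfl, Fintype.sum_sum_type]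
  · simp only [s, Sum.elim_inl, Sum.elim_inr, Function.comp_apply]
    change ∑ i, (((exchangePerm f g hj (colBox μ j₁ (f i))).1.2 : ℤ) - _) * _ +
      ∑ i, (((exchangePerm f g hj (colBox μ j₂ (g i))).1.2 : ℤ) - _) * _ = _
    simp only [hleft, hright, colBox_col, ← Finset.mul_sum]
    ring
  · change (((exchangePerm f g hj c).1.2 : ℤ) - _) * _ = 0
    rw [hfix c hc, sub_self, zero_mul]

theorem sum_two_pow_lt_of_row_descent {T : Box μ → Fin m} (hT : ∀ j, StrictMono (T ∘ colBox μ j))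
    {c c' : Box μ} (hrow : c.1.1 = c'.1.1) (hlt : T c' < T c)
    (hc' : c'.1.1 + 1 ≤ μ.colLen c'.1.2) (f : Fin (c'.1.1 + 1) ↪o Fin (μ.colLen c.1.2)) :
    ∑ i, 2 ^ (T (colBox μ c'.1.2 (Fin.castLEOrderEmb hc' i)) : ℕ) <
      ∑ i, 2 ^ (T (colBox μ c.1.2 (f i)) : ℕ) := by
  have hc : (T c : ℕ) ≤ T (colBox μ c.1.2 (f (Fin.last _))) := by
    obtain ⟨i, hi⟩ := exists_colBox_eq c
    have hic : (i : ℕ) = c'.1.1 := (congrArg (fun c : Box μ => c.1.1) hi).trans hrow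
    conv_lhs => rw [← hi]
    exact (hT _).monotone
      (Fin.le_def.2 (hic.trans_le (val_le_val_of_strictMono f.strictMono (Fin.last _))))
  calc ∑ i, 2 ^ (T (colBox μ c'.1.2 (Fin.castLEOrderEmb hc' i)) : ℕ)
      < 2 ^ ((T c' : ℕ) + 1) := sum_two_pow_lt_of_strictMono
        (a := fun i => (T (colBox μ c'.1.2 (Fin.castLEOrderEmb hc' i)) : ℕ))
        fun _ _ hab => hT _ ((Fin.castLEOrderEmb hc').strictMono hab)
    _ ≤ 2 ^ (T (colBox μ c.1.2 (f (Fin.last _))) : ℕ) :=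
        Nat.pow_le_pow_right two_pos (hc.trans' hlt)
    _ ≤ ∑ i, 2 ^ (T (colBox μ c.1.2 (f i)) : ℕ) :=
        Finset.single_le_sum (f := fun i => 2 ^ (T (colBox μ c.1.2 (f i)) : ℕ))
          (fun _ _ => Nat.zero_le _) (Finset.mem_univ _)

theorem colWeight_lt_colWeight_exchange {T : Box μ → Fin m}
    (hT : ∀ j, StrictMono (T ∘ colBox μ j)) {c c' : Box μ} (hrow : c.1.1 = c'.1.1)
    (hcol : c.1.2 < c'.1.2) (hlt : T c' < T c) (hc' : c'.1.1 + 1 ≤ μ.colLen c'.1.2)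
    (f : Fin (c'.1.1 + 1) ↪o Fin (μ.colLen c.1.2)) :
    colWeight T < colWeight (exchange T f (Fin.castLEOrderEmb hc')) := by
  rw [← sub_pos, colWeight_exchange_sub T hcol.ne]
  refine mul_pos (by lia) (sub_pos.2 ?_)
  exact_mod_cast sum_two_pow_lt_of_row_descent hT hrow hlt hc' f

variable {V : Type u} [AddCommGroup V] [Module ℝ V]

theorem schurH_mem_span_semistandard (b : Fin m → V) (T : Box μ → Fin m) :
    schurH μ V (b ∘ T) ∈ Submodule.span ℝ
      ((fun T : Box μ → Fin m => schurH μ V (b ∘ T)) '' {T | IsSemistandard T}) := by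
  let weight : (Box μ → Fin m) → ℤ ×ₗ ℤ := fun T => toLex (colWeight T, rowWeight T)
  have hwf : WellFounded fun T T' => weight T' < weight T :=
    InvImage.wf (Set.rangeFactorization weight) wellFounded_gt
  induction T using hwf.induction with
  | _ T ih =>
  by_cases hcol : ∀ j, StrictMono (T ∘ colBox μ j)
  · by_cases hrow : ∀ c c' : Box μ, c.1.1 = c'.1.1 → c.1.2 < c'.1.2 → T c ≤ T c'
    · exact Submodule.subset_span ⟨T, ⟨hrow, hcol⟩, rfl⟩
    · push Not at hrow
      obtain ⟨c, c', hr, hc, hlt⟩ := hrow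
      have hc' : c'.1.1 + 1 ≤ μ.colLen c'.1.2 :=
        YoungDiagram.mem_iff_lt_colLen.1 ((YoungDiagram.mem_cells _).1 c'.2)
      rw [schurH_exchangeAxioms.exchange _ _ hc _ (Fin.castLEOrderEmb hc')]
      refine Submodule.sum_mem _ fun f _ => ?_
      rw [Function.comp_def, ← comp_exchange μ b]
      exact ih _ (Prod.Lex.left _ _ (colWeight_lt_colWeight_exchange hcol hr hc hlt hc' f))
  · simp only [StrictMono, not_forall, not_lt] at hcol
    obtain ⟨j, i, i', hi, hle⟩ := hcol
    have hne : colBox μ j i ≠ colBox μ j i' := (colBox_injective j).ne hi.ne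
    obtain heq | hlt := hle.eq_or_lt
    · rw [schurH_exchangeAxioms.alternating _ _ _ hne rfl (congrArg b heq.symm)]
      exact Submodule.zero_mem _
    · have hcol : colWeight T = colWeight (T ∘ Equiv.swap (colBox μ j i) (colBox μ j i')) :=
        (colWeight_swap T (b := colBox μ j i) (b' := colBox μ j i') rfl).symm
      have hrow : rowWeight T < rowWeight (T ∘ Equiv.swap (colBox μ j i) (colBox μ j i')) :=
        rowWeight_lt_rowWeight_swap (b := colBox μ j i) (b' := colBox μ j i') hi hlt
      have hswap := ih _ (Prod.Lex.toLex_lt_toLex.2 (Or.inr ⟨hcol, hrow⟩))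
      rwa [← Function.comp_assoc, schurH_swap hne rfl, Submodule.neg_mem_iff] at hswap

theorem span_semistandard_eq_top {b : Fin m → V} (hb : Submodule.span ℝ (Set.range b) = ⊤) :
    Submodule.span ℝ
      ((fun T : Box μ → Fin m => schurH μ V (b ∘ T)) '' {T | IsSemistandard T}) = ⊤ := by
  rw [eq_top_iff, ← span_range_schurH, Submodule.span_le]
  rintro _ ⟨v, rfl⟩
  refine multilinear_mem_of_mem_span (M := schurH μ V) (A := fun _ => Set.range b)
    (fun v hv => ?_) fun _ => hb ▸ trivial
  choose T hT using hv
  obtain rfl : b ∘ T = v := funext hT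
  exact schurH_mem_span_semistandard b T

end Straightening

/-! ### Sylvester's exchange identity -/

theorem extend_comp_self {ι κ M : Type*} (f : κ ↪ ι) (v : ι → M) :
    Function.extend f (v ∘ f) v = v := by
  funext a
  by_cases ha : ∃ i, f i = a
  · obtain ⟨i, rfl⟩ := ha
    exact f.injective.extend_apply _ _ i
  · exact Function.extend_apply' _ _ _ ha

theorem extend_update {ι κ M : Type*} [DecidableEq ι] [DecidableEq κ] (f : κ ↪ ι) (w : κ → M)
    (v : ι → M) (i : κ) (x : M) :
    Function.extend f (Function.update w i x) v =
      Function.update (Function.extend f w v) (f i) x := by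
  funext a
  by_cases ha : ∃ k, f k = a
  · obtain ⟨k, rfl⟩ := ha
    simp only [f.injective.extend_apply, Function.update_apply, f.injective.eq_iff]
  · rw [Function.extend_apply' _ _ _ ha, Function.update_of_ne fun h => ha ⟨i, h.symm⟩,
      Function.extend_apply' _ _ _ ha]

section Sylvester

variable {R ι κ M N : Type*} [CommRing R] [AddCommGroup M] [Module R M] [AddCommGroup N]
  [Module R N]

/-- The alternating map obtained by fixing the arguments of `D` outside the range of `f`. -/
noncomputable def alternatingExtend (D : M [⋀^ι]→ₗ[R] N) (f : κ ↪ ι) (v : ι → M) :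
    M [⋀^κ]→ₗ[R] N where
  toFun w := D (Function.extend f w v)
  map_update_add' w i x y := by
    classical
    simp only [extend_update, D.map_update_add]
  map_update_smul' w i r x := by
    classical
    simp only [extend_update, D.map_update_smul]
  map_eq_zero_of_eq' w i j h hij := by
    refine D.map_eq_zero_of_eq (i := f i) (j := f j) _ ?_ (f.injective.ne hij)
    rw [f.injective.extend_apply, f.injective.extend_apply, h]

variable {p k : ℕ}

theorem exists_notMem_range_of_ne {f g : Fin k ↪o Fin p} (h : f ≠ g) :
    ∃ i, f i ∉ Set.range g := by
  by_contra! hfg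
  refine h (OrderEmbedding.range_inj.1
    (Set.eq_of_subset_of_ncard_le (Set.range_subset_iff.2 hfg) ?_))
  rw [← Set.image_univ, ← Set.image_univ, Set.ncard_image_of_injective _ f.injective,
    Set.ncard_image_of_injective _ g.injective]

theorem alternatingMap_ext_orderEmbedding {F G : M [⋀^Fin k]→ₗ[R] N}
    (b : Module.Basis (Fin p) R M) (h : ∀ f : Fin k ↪o Fin p, F (b ∘ f) = G (b ∘ f)) : F = G := by
  refine b.ext_alternating fun g hg => ?_
  have hsort := h (OrderEmbedding.ofStrictMono (g ∘ Tuple.sort g)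
    ((Tuple.monotone_sort g).strictMono_of_injective (hg.comp (Tuple.sort g).injective)))
  rw [OrderEmbedding.coe_ofStrictMono, ← Function.comp_assoc, F.map_perm, G.map_perm] at hsort
  exact smul_left_cancel _ hsort

theorem alternating_extend_comp_eq_zero (D : M [⋀^Fin p]→ₗ[R] N) {f g : Fin k ↪o Fin p}
    (h : f ≠ g) (v : Fin p → M) : D (Function.extend f (v ∘ g) v) = 0 := by
  obtain ⟨i, hi⟩ := exists_notMem_range_of_ne h.symm
  refine D.map_eq_zero_of_eq _ ?_ fun hfg : f i = g i => hi ⟨i, hfg⟩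
  rw [f.injective.extend_apply, Function.extend_apply' _ _ _ hi, Function.comp_apply]

theorem alternating_exchange_of_basis (D : M [⋀^Fin p]→ₗ[R] R) (F : M [⋀^Fin k]→ₗ[R] R)
    (b : Module.Basis (Fin p) R M) (w : Fin k → M) :
    D b * F w = ∑ f : Fin k ↪o Fin p, D (Function.extend f w b) * F (b ∘ f) := by
  have hsum (w : Fin k → M) :
      (∑ f : Fin k ↪o Fin p, F (b ∘ f) • alternatingExtend D f.toEmbedding b) w =
        ∑ f : Fin k ↪o Fin p, D (Function.extend f w b) * F (b ∘ f) := by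
    refine (DFunLike.congr_fun (map_sum (AlternatingMap.toMultilinearMapLM (S := R)) _ _) w).trans
      ((sum_apply _ _ _).trans ?_)
    exact Finset.sum_congr rfl fun f _ => mul_comm (F (b ∘ f)) _
  suffices h : D b • F =
      ∑ f : Fin k ↪o Fin p, F (b ∘ f) • alternatingExtend D f.toEmbedding b by
    rw [← hsum, ← h, AlternatingMap.smul_apply, smul_eq_mul]
  refine alternatingMap_ext_orderEmbedding b fun g => ?_
  rw [hsum, Fintype.sum_eq_single g fun f hf => by
    rw [alternating_extend_comp_eq_zero D hf, zero_mul]]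
  exact congrArg (D · * F (b ∘ g)) (extend_comp_self g.toEmbedding b).symm

theorem dense_setOf_det_ne_zero {𝕜 n : Type*} [NontriviallyNormedField 𝕜] [Fintype n]
    [DecidableEq n] : Dense {A : Matrix n n 𝕜 | A.det ≠ 0} := by
  intro A
  classical
  have hfin : {t : 𝕜 | (Matrix.scalar n t - -A).det = 0}.Finite := by
    refine ((-A).charpoly.roots.toFinset.finite_toSet).subset fun t ht => ?_
    rw [Finset.mem_coe, Multiset.mem_toFinset, Polynomial.mem_roots (-A).charpoly_monic.ne_zero,
      Polynomial.IsRoot, Matrix.eval_charpoly]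
    exact ht
  have hcont : Continuous fun t : 𝕜 => Matrix.scalar n t - -A := by
    simp only [Matrix.scalar_apply]
    fun_prop
  have hmem := map_mem_closure hcont ((dense_univ.sdiff_finite hfin) 0)
    fun t ht => show _ ∈ {A : Matrix n n 𝕜 | A.det ≠ 0} from ht.2
  simpa only [map_zero, zero_sub, neg_neg] using hmem

theorem det_mul_alternating {𝕜 : Type*} [NontriviallyNormedField 𝕜]
    (F : (Fin p → 𝕜) [⋀^Fin k]→ₗ[𝕜] 𝕜) (v : Fin p → Fin p → 𝕜) (w : Fin k → Fin p → 𝕜) :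
    (Matrix.of v).det * F w =
      ∑ f : Fin k ↪o Fin p, (Matrix.of (Function.extend f w v)).det * F (v ∘ f) := by
  have hF : Continuous F := continuous_multilinearMap F.toMultilinearMap
  have hdet : Continuous fun v : Fin p → Fin p → 𝕜 => (Matrix.of v).det :=
    continuous_id.matrix_det
  have hextend (f : Fin k ↪o Fin p) :
      Continuous fun v : Fin p → Fin p → 𝕜 => Function.extend f w v := by
    refine continuous_pi fun i => ?_
    by_cases hi : ∃ a, f a = i
    · obtain ⟨a, rfl⟩ := hi
      simpa only [f.injective.extend_apply] using continuous_const
    · simpa only [Function.extend_apply' _ _ _ hi] using continuous_apply i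
  refine congrFun (Continuous.ext_on dense_setOf_det_ne_zero
    (f := fun v : Fin p → Fin p → 𝕜 => (Matrix.of v).det * F w) (g := fun v =>
      ∑ f : Fin k ↪o Fin p, (Matrix.of (Function.extend f w v)).det * F (v ∘ f))
    (hdet.mul continuous_const)
    (continuous_finsetSum _ fun f _ => (hdet.comp (hextend f)).mul
      (hF.comp (continuous_pi fun i => continuous_apply (f i)))) fun v hv => ?_) v
  have hli : LinearIndependent 𝕜 v := Matrix.linearIndependent_rows_iff_isUnit.2
    ((Matrix.isUnit_iff_isUnit_det _).2 (isUnit_iff_ne_zero.2 hv))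
  let b := Module.Basis.mk hli (hli.span_eq_top_of_card_eq_finrank' (by simp)).ge
  have hb : (b : Fin p → Fin p → 𝕜) = v := Module.Basis.coe_mk _ _
  have h := alternating_exchange_of_basis Matrix.detRowAlternating F b w
  rwa [hb] at h

end Sylvester

/-! ### Products of column determinants -/

section ColumnProduct

variable {μ : YoungDiagram} {X : Type*}

theorem exists_colBox_fin_eq (c : Box μ) :
    ∃ (j : Fin (μ.rowLen 0)) (i : Fin (μ.colLen j)), colBox μ j i = c := by
  obtain ⟨i, hi⟩ := exists_colBox_eq c
  exact ⟨⟨c.1.2, YoungDiagram.mem_iff_lt_rowLen.1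
    (μ.up_left_mem (Nat.zero_le _) le_rfl ((YoungDiagram.mem_cells _).1 c.2))⟩, i, hi⟩

variable {j j₁ j₂ k : ℕ}

theorem exchange_comp_colBox_left (h : j₁ ≠ j₂) (v : Box μ → X) (f : Fin k ↪o Fin (μ.colLen j₁))
    (g : Fin k ↪o Fin (μ.colLen j₂)) : exchange v f g ∘ colBox μ j₁ =
      Function.extend f ((v ∘ colBox μ j₂) ∘ g) (v ∘ colBox μ j₁) := by
  funext a
  by_cases ha : ∃ i, f i = a
  · obtain ⟨i, rfl⟩ := ha
    rw [f.injective.extend_apply]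
    exact exchange_left v f g i
  · rw [Function.extend_apply' _ _ _ ha]
    exact exchange_of_ne v f g (fun i hi => ha ⟨i, colBox_injective _ hi⟩)
      fun i => (colBox_ne h _ _).symm

theorem exchange_comp_colBox_right (h : j₁ ≠ j₂) (v : Box μ → X)
    (f : Fin k ↪o Fin (μ.colLen j₁)) (g : Fin k ↪o Fin (μ.colLen j₂)) :
    exchange v f g ∘ colBox μ j₂ =
      Function.extend g ((v ∘ colBox μ j₁) ∘ f) (v ∘ colBox μ j₂) := by
  funext a
  by_cases ha : ∃ i, g i = a
  · obtain ⟨i, rfl⟩ := ha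
    rw [g.injective.extend_apply]
    exact exchange_right v f g h i
  · rw [Function.extend_apply' _ _ _ ha]
    exact exchange_of_ne v f g (fun i => colBox_ne h _ _)
      fun i hi => ha ⟨i, colBox_injective _ hi⟩

theorem exchange_comp_colBox_of_ne (h₁ : j₁ ≠ j) (h₂ : j₂ ≠ j) (v : Box μ → X)
    (f : Fin k ↪o Fin (μ.colLen j₁)) (g : Fin k ↪o Fin (μ.colLen j₂)) :
    exchange v f g ∘ colBox μ j = v ∘ colBox μ j :=
  funext fun a => exchange_of_ne v f g (fun i => colBox_ne h₁ (f i) a)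
    fun i => colBox_ne h₂ (g i) a

variable {R A V E : Type*} [CommSemiring R] [CommSemiring A] [Algebra R A] [AddCommMonoid V]
  [Module R V]

theorem prod_update_comp_colBox [DecidableEq (Box μ)]
    (D : ∀ j, (Fin (μ.colLen j) → X) → A) (v : Box μ → X) (j : Fin (μ.rowLen 0))
    (i : Fin (μ.colLen j)) (x : X) :
    ∏ j' : Fin (μ.rowLen 0), D j' (Function.update v (colBox μ j i) x ∘ colBox μ j') =
      D j (Function.update (v ∘ colBox μ j) i x) *
        ∏ j' ∈ Finset.univ.erase j, D j' (v ∘ colBox μ j') := by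
  rw [← Finset.mul_prod_erase _ _ (Finset.mem_univ j),
    Function.update_comp_eq_of_injective _ (colBox_injective _)]
  refine congrArg _ (Finset.prod_congr rfl fun j' hj' => congrArg _ ?_)
  exact Function.update_comp_eq_of_forall_ne _ _ fun i' =>
    colBox_ne (fun h => Finset.ne_of_mem_erase hj' (Fin.ext h)) i' i

/-- The product over all columns of alternating forms in the entries of the columns. -/
def colProd (D : ∀ j, V [⋀^Fin (μ.colLen j)]→ₗ[R] A) : MultilinearMap R (fun _ : Box μ => V) A where
  toFun v := ∏ j : Fin (μ.rowLen 0), D j (v ∘ colBox μ j)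
  map_update_add' v c x y := by
    obtain ⟨j, i, rfl⟩ := exists_colBox_fin_eq c
    simp only [prod_update_comp_colBox fun j => D j, (D j).map_update_add, add_mul]
  map_update_smul' v c t x := by
    obtain ⟨j, i, rfl⟩ := exists_colBox_fin_eq c
    simp only [prod_update_comp_colBox fun j => D j, (D j).map_update_smul, smul_mul_assoc]

theorem colProd_eq_zero (D : ∀ j, V [⋀^Fin (μ.colLen j)]→ₗ[R] A) {v : Box μ → V} {b b' : Box μ}
    (hb : b ≠ b') (hc : b.1.2 = b'.1.2) (hv : v b = v b') : colProd D v = 0 := by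
  obtain ⟨j, i, rfl⟩ := exists_colBox_fin_eq b
  obtain ⟨i', rfl⟩ : ∃ i', colBox μ j i' = b' := by
    rw [colBox_col] at hc
    rw [hc]
    exact exists_colBox_eq b'
  exact Finset.prod_eq_zero (Finset.mem_univ j)
    ((D j).map_eq_zero_of_eq _ hv fun h => hb (congrArg _ h))

end ColumnProduct

section Exchange

variable {μ : YoungDiagram} {R A V : Type*} [CommRing R] [CommRing A] [Algebra R A]
  [AddCommGroup V] [Module R V]

theorem exchangeAxioms_colProd {D : ∀ j, V [⋀^Fin (μ.colLen j)]→ₗ[R] A}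
    (hD : ∀ j₁ j₂, j₁ < j₂ → ∀ (k : ℕ) (g : Fin k ↪o Fin (μ.colLen j₂))
      (v : Fin (μ.colLen j₁) → V) (w : Fin (μ.colLen j₂) → V),
      D j₁ v * D j₂ w = ∑ f : Fin k ↪o Fin (μ.colLen j₁),
        D j₁ (Function.extend f (w ∘ g) v) * D j₂ (Function.extend g (v ∘ f) w)) :
    ExchangeAxioms μ (colProd D) where
  alternating v b b' hb hc hv := colProd_eq_zero D hb hc hv
  exchange j₁ j₂ hj k g v := by
    obtain rfl | hk := Nat.eq_zero_or_pos k
    · have : Unique (Fin 0 ↪o Fin (μ.colLen j₁)) :=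
        { default := RelEmbedding.ofIsEmpty _ _, uniq := fun f => by ext i; exact i.elim0 }
      rw [Fintype.sum_unique]
      exact congrArg _ (funext fun c =>
        (exchange_of_ne v _ g (fun i => i.elim0) fun i => i.elim0).symm)
    obtain ⟨c₂, i, hc₂⟩ := exists_colBox_fin_eq (colBox μ j₂ (g ⟨0, hk⟩))
    obtain rfl : (c₂ : ℕ) = j₂ := congrArg (fun c : Box μ => c.1.2) hc₂
    lift j₁ to Fin (μ.rowLen 0) using hj.trans c₂.2
    have hsplit (u : Box μ → V) : colProd D u =
        D j₁ (u ∘ colBox μ j₁) * D c₂ (u ∘ colBox μ c₂) *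
          ∏ j ∈ (Finset.univ.erase j₁).erase c₂, D j (u ∘ colBox μ j) := by
      rw [mul_assoc, Finset.mul_prod_erase _ (fun j : Fin (μ.rowLen 0) => D j (u ∘ colBox μ j))
        (Finset.mem_erase.2 ⟨(Fin.lt_def.2 hj).ne', Finset.mem_univ _⟩),
        Finset.mul_prod_erase _ (fun j : Fin (μ.rowLen 0) => D j (u ∘ colBox μ j))
        (Finset.mem_univ _)]
      rfl
    rw [hsplit, hD j₁ c₂ hj k g, Finset.sum_mul]
    refine Finset.sum_congr rfl fun f _ => ?_
    rw [hsplit, exchange_comp_colBox_left hj.ne, exchange_comp_colBox_right hj.ne]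
    refine congrArg _ (Finset.prod_congr rfl fun j hmem => ?_)
    rw [Finset.mem_erase, Finset.mem_erase] at hmem
    rw [exchange_comp_colBox_of_ne (fun h => hmem.2.1 (Fin.ext h.symm))
      fun h => hmem.1 (Fin.ext h.symm)]

/-- The determinant of the first `n` coordinates of `n` vectors, with coordinates in an algebra
read off by `L`. -/
def truncDet (L : V →ₗ[R] ℕ → A) (n : ℕ) : V [⋀^Fin n]→ₗ[R] A where
  toMultilinearMap :=
    ((Matrix.detRowAlternating : (Fin n → A) [⋀^Fin n]→ₗ[A] A).toMultilinearMap.restrictScalars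
      R).compLinearMap fun _ => LinearMap.funLeft R A Fin.val ∘ₗ L
  map_eq_zero_of_eq' _ _ _ hv hij :=
    Matrix.detRowAlternating.map_eq_zero_of_eq _ (congrArg (LinearMap.funLeft R A Fin.val ∘ₗ L) hv)
      hij

theorem truncDet_apply (L : V →ₗ[R] ℕ → A) (n : ℕ) (v : Fin n → V) :
    truncDet L n v = (Matrix.of fun i (r : Fin n) => L (v i) r).det := rfl

theorem map_truncDet {B : Type*} [CommRing B] [Algebra R B] (φ : A →ₐ[R] B) (L : V →ₗ[R] ℕ → A)
    (n : ℕ) (v : Fin n → V) :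
    φ (truncDet L n v) = truncDet (φ.toLinearMap.compLeft ℕ ∘ₗ L) n v :=
  φ.map_det _

theorem truncDet_mul_truncDet_of_field {𝕜 V : Type*} [NontriviallyNormedField 𝕜]
    [AddCommGroup V] [Module 𝕜 V] (L : V →ₗ[𝕜] ℕ → 𝕜) {n₁ n₂ k : ℕ} (hn : n₂ ≤ n₁)
    (g : Fin k ↪o Fin n₂) (v : Fin n₁ → V) (w : Fin n₂ → V) :
    truncDet L n₁ v * truncDet L n₂ w = ∑ f : Fin k ↪o Fin n₁,
      truncDet L n₁ (Function.extend f (w ∘ g) v) *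
        truncDet L n₂ (Function.extend g (v ∘ f) w) := by
  let trunc (n : ℕ) : V →ₗ[𝕜] Fin n → 𝕜 := LinearMap.funLeft 𝕜 𝕜 Fin.val ∘ₗ L
  let F : (Fin n₁ → 𝕜) [⋀^Fin k]→ₗ[𝕜] 𝕜 :=
    (alternatingExtend Matrix.detRowAlternating g.toEmbedding (trunc n₂ ∘ w)).compLinearMap
      (LinearMap.funLeft 𝕜 𝕜 (Fin.castLE hn))
  have hF (u : Fin k → V) : F (trunc n₁ ∘ u) = truncDet L n₂ (Function.extend g u w) :=
    congrArg Matrix.det (funext fun i => (Function.apply_extend (trunc n₂) g w i).symm)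
  have h := det_mul_alternating F (trunc n₁ ∘ v) (trunc n₁ ∘ w ∘ g)
  rw [hF, show Function.extend g (w ∘ g) w = w from extend_comp_self g.toEmbedding w] at h
  refine h.trans (Finset.sum_congr rfl fun f _ => ?_)
  rw [Function.comp_assoc, hF]
  exact congrArg (· * _) (congrArg Matrix.det
    (funext fun i => (Function.apply_extend (trunc n₁) f v i).symm))

theorem truncDet_mul_truncDet {𝕜 σ V : Type*} [NontriviallyNormedField 𝕜] [AddCommGroup V]
    [Module 𝕜 V] (L : V →ₗ[𝕜] ℕ → MvPolynomial σ 𝕜) {n₁ n₂ k : ℕ} (hn : n₂ ≤ n₁)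
    (g : Fin k ↪o Fin n₂) (v : Fin n₁ → V) (w : Fin n₂ → V) :
    truncDet L n₁ v * truncDet L n₂ w = ∑ f : Fin k ↪o Fin n₁,
      truncDet L n₁ (Function.extend f (w ∘ g) v) *
        truncDet L n₂ (Function.extend g (v ∘ f) w) := by
  refine MvPolynomial.funext fun z => ?_
  simp only [← MvPolynomial.coe_aeval_eq_eval, RingHom.coe_coe, map_sum, map_mul, map_truncDet]
  exact truncDet_mul_truncDet_of_field _ hn g v w

end Exchange

/-! ### Linear independence of the semistandard tableaux -/

section GenericTableau

variable {μ : YoungDiagram} {m : ℕ} {R : Type*} {V : Type*} [CommRing R] [AddCommGroup V]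
  [Module R V]

/-- The linear map sending the basis vector `b s` to the family of variables `X (r, s)`. -/
noncomputable def genericMap (b : Module.Basis (Fin m) R V) :
    V →ₗ[R] ℕ → MvPolynomial (ℕ × Fin m) R :=
  b.constr R fun s r => MvPolynomial.X (r, s)

/-- The product of the generic column determinants, a model of the Schur module in which the
semistandard tableaux are visibly independent. -/
noncomputable def genericTableau (μ : YoungDiagram) (b : Module.Basis (Fin m) R V) :
    MultilinearMap R (fun _ : Box μ => V) (MvPolynomial (ℕ × Fin m) R) :=
  colProd fun j => truncDet (genericMap b) (μ.colLen j)

theorem exchangeAxioms_genericTableau {V : Type*} [AddCommGroup V] [Module ℝ V]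
    (b : Module.Basis (Fin m) ℝ V) : ExchangeAxioms μ (genericTableau μ b) :=
  exchangeAxioms_colProd fun _ _ hj _ => truncDet_mul_truncDet _ (μ.colLen_anti _ _ hj.le)

theorem truncDet_genericMap (b : Module.Basis (Fin m) R V) {n : ℕ} (t : Fin n → Fin m) :
    truncDet (genericMap b) n (b ∘ t) = ∑ σ : Equiv.Perm (Fin n), MvPolynomial.monomial
      (∑ i, Finsupp.single ((σ i : ℕ), t i) 1) ((Equiv.Perm.sign σ : ℤ) : R) := by
  rw [truncDet_apply, ← Matrix.det_transpose, Matrix.det_apply]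
  refine Finset.sum_congr rfl fun σ _ => ?_
  have hprod : ∏ i, (Matrix.of fun i (r : Fin n) =>
      genericMap b ((b ∘ t) i) r).transpose (σ i) i =
        MvPolynomial.monomial (∑ i, Finsupp.single ((σ i : ℕ), t i) 1) (1 : R) := by
    rw [MvPolynomial.monomial_sum_one]
    refine Finset.prod_congr rfl fun i _ => ?_
    rw [Matrix.transpose_apply, Matrix.of_apply, Function.comp_apply, genericMap, b.constr_basis,
      MvPolynomial.X]
  rw [hprod, Units.smul_def, ← Int.cast_smul_eq_zsmul R, MvPolynomial.smul_monomial, smul_eq_mul,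
    mul_one]

/-- A column permutation is a family of permutations of the columns. -/
abbrev ColPerm (μ : YoungDiagram) : Type := ∀ j : Fin (μ.rowLen 0), Equiv.Perm (Fin (μ.colLen j))

/-- The exponent of the monomial that the column permutation `σ` contributes to the generic
tableau of the filling `T`. -/
noncomputable def colExponent (σ : ColPerm μ) (T : Box μ → Fin m) : ℕ × Fin m →₀ ℕ :=
  ∑ j : Fin (μ.rowLen 0), ∑ i, Finsupp.single ((σ j i : ℕ), T (colBox μ j i)) 1

theorem genericTableau_comp (b : Module.Basis (Fin m) R V) (T : Box μ → Fin m) :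
    genericTableau μ b (b ∘ T) = ∑ σ : ColPerm μ,
      MvPolynomial.monomial (colExponent σ T) (∏ j, ((Equiv.Perm.sign (σ j) : ℤ) : R)) := by
  simp only [colExponent, MvPolynomial.monomial_sum_prod]
  change ∏ j : Fin (μ.rowLen 0),
    truncDet (genericMap b) (μ.colLen j) (b ∘ T ∘ colBox μ j) = _
  simp only [truncDet_genericMap, Finset.prod_univ_sum, Fintype.piFinset_univ, Function.comp_apply]

theorem sum_box {A : Type*} [AddCommMonoid A] (F : Box μ → A) :
    ∑ c, F c = ∑ j : Fin (μ.rowLen 0), ∑ i, F (colBox μ j i) := by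
  rw [← Fintype.sum_sigma' fun (j : Fin (μ.rowLen 0)) i => F (colBox μ j i)]
  refine (Fintype.sum_bijective (fun x : Σ j : Fin (μ.rowLen 0), Fin (μ.colLen j) =>
    colBox μ x.1 x.2) ⟨?_, fun c => ?_⟩ _ _ fun _ => rfl).symm
  · rintro ⟨j, i⟩ ⟨j', i'⟩ h
    obtain rfl : j = j' := Fin.ext (congrArg (fun c : Box μ => c.1.2) h)
    rw [colBox_injective (μ := μ) (j : ℕ) (show colBox μ j i = colBox μ j i' from h)]
  · obtain ⟨j, i, hi⟩ := exists_colBox_fin_eq c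
    exact ⟨⟨j, i⟩, hi⟩

end GenericTableau

section ExponentWeight

variable {μ : YoungDiagram} {m : ℕ}

/-- The weight of an exponent in which the variable `X (r, s)` has weight `r * s`. -/
noncomputable def expWeight : (ℕ × Fin m →₀ ℕ) →+ ℤ :=
  Finsupp.weight fun x : ℕ × Fin m => (x.1 : ℤ) * ((x.2 : ℕ) : ℤ)

theorem expWeight_colExponent (σ : ColPerm μ) (T : Box μ → Fin m) :
    expWeight (colExponent σ T) =
      ∑ j : Fin (μ.rowLen 0), ∑ i, ((σ j i : ℕ) : ℤ) * ((T (colBox μ j i) : ℕ) : ℤ) := by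
  simp only [colExponent, map_sum, expWeight, Finsupp.weight_single, one_smul]

theorem expWeight_colExponent_one (T : Box μ → Fin m) :
    expWeight (colExponent 1 T) = rowWeight T :=
  (expWeight_colExponent 1 T).trans
    (sum_box fun c : Box μ => (c.1.1 : ℤ) * ((T c : ℕ) : ℤ)).symm

theorem IsSemistandard.monovary_col {T : Box μ → Fin m} (hT : IsSemistandard T) (j : ℕ) :
    Monovary (fun i : Fin (μ.colLen j) => ((i : ℕ) : ℤ))
      fun i => ((T (colBox μ j i) : ℕ) : ℤ) := fun _ _ hab =>
  Int.ofNat_le.2 (Fin.le_def.1 ((hT.col j).lt_iff_lt.1 (Fin.lt_def.2 (Int.ofNat_lt.1 hab))).le)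

theorem expWeight_colExponent_le {T : Box μ → Fin m} (hT : IsSemistandard T) (σ : ColPerm μ) :
    expWeight (colExponent σ T) ≤ rowWeight T := by
  rw [← expWeight_colExponent_one, expWeight_colExponent, expWeight_colExponent]
  exact Finset.sum_le_sum fun j _ => (hT.monovary_col j).sum_comp_perm_mul_le_sum_mul

theorem eq_one_of_expWeight_eq {T : Box μ → Fin m} (hT : IsSemistandard T) {σ : ColPerm μ}
    (h : expWeight (colExponent σ T) = rowWeight T) : σ = 1 := by
  rw [← expWeight_colExponent_one, expWeight_colExponent, expWeight_colExponent] at h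
  have hcol := (Finset.sum_eq_sum_iff_of_le fun (j : Fin (μ.rowLen 0)) _ =>
    (hT.monovary_col j).sum_comp_perm_mul_le_sum_mul (σ := σ j)).1 h
  funext j
  have hvary := (hT.monovary_col j).sum_comp_perm_mul_eq_sum_mul_iff.1 (hcol j (Finset.mem_univ j))
  have hmono : StrictMono (σ j) := by
    refine Monotone.strictMono_of_injective (fun a b hab => ?_) (σ j).injective
    obtain rfl | hab := hab.eq_or_lt
    · exact le_rfl
    · exact Fin.le_def.2 (Int.ofNat_le.1 (hvary (Int.ofNat_lt.2 (Fin.lt_def.1 (hT.col j hab)))))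
  exact Equiv.ext fun i => le_antisymm hmono.apply_le hmono.le_apply

theorem colExponent_one_apply (T : Box μ → Fin m) (r : ℕ) (s : Fin m) :
    colExponent 1 T (r, s) = (Finset.univ.filter fun c : Box μ => c.1.1 = r ∧ T c = s).card := by
  have hsum : colExponent 1 T = ∑ c : Box μ, Finsupp.single (c.1.1, T c) 1 :=
    (sum_box fun c => Finsupp.single (c.1.1, T c) 1).symm
  rw [hsum, Finsupp.finsetSum_apply, Finset.card_filter]
  exact Finset.sum_congr rfl fun c _ => by simp only [Finsupp.single_apply, Prod.mk.injEq]

/-- The box in column `j` of row `i`. -/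
def rowBox (μ : YoungDiagram) (i : ℕ) (j : Fin (μ.rowLen i)) : Box μ :=
  ⟨(i, (j : ℕ)), (YoungDiagram.mem_cells _).2 (YoungDiagram.mem_iff_lt_rowLen.2 j.2)⟩

theorem rowBox_injective (i : ℕ) : Function.Injective (rowBox μ i) := fun _ _ h =>
  Fin.ext (congrArg (fun c : Box μ => c.1.2) h)

theorem exists_rowBox_eq (c : Box μ) : ∃ j, rowBox μ c.1.1 j = c :=
  ⟨⟨c.1.2, YoungDiagram.mem_iff_lt_rowLen.1 ((YoungDiagram.mem_cells _).1 c.2)⟩, rfl⟩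

theorem count_map_rowBox (T : Box μ → Fin m) (i : ℕ) (s : Fin m) :
    Multiset.count s (Multiset.map (T ∘ rowBox μ i) Finset.univ.val) =
      colExponent 1 T (i, s) := by
  rw [colExponent_one_apply, Multiset.count_map, ← Finset.filter_val, Finset.card_val,
    ← Finset.card_map ⟨_, rowBox_injective i⟩]
  congr 1
  ext c
  simp only [Finset.mem_map, Finset.mem_filter, Finset.mem_univ, true_and,
    Function.Embedding.coeFn_mk, Function.comp_apply]
  constructor
  · rintro ⟨j, hj, rfl⟩
    exact ⟨rfl, hj.symm⟩
  · rintro ⟨rfl, hs⟩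
    obtain ⟨j, hj⟩ := exists_rowBox_eq c
    exact ⟨j, by rw [hj, hs], hj⟩

theorem IsSemistandard.monotone_row {T : Box μ → Fin m} (hT : IsSemistandard T) (i : ℕ) :
    Monotone (T ∘ rowBox μ i) := fun _ _ hab =>
  hab.eq_or_lt.elim (fun h => h ▸ le_rfl) fun h => hT.row _ _ rfl (Fin.lt_def.1 h)

theorem eq_of_colExponent_one_eq {S T : Box μ → Fin m} (hS : IsSemistandard S)
    (hT : IsSemistandard T) (h : colExponent 1 S = colExponent 1 T) : S = T := by
  funext c
  have hperm : (List.ofFn (S ∘ rowBox μ c.1.1)).Perm (List.ofFn (T ∘ rowBox μ c.1.1)) := by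
    rw [← Multiset.coe_eq_coe, ← Fin.univ_val_map, ← Fin.univ_val_map]
    exact Multiset.ext.2 fun s => by rw [count_map_rowBox, count_map_rowBox, h]
  have hrow := List.ofFn_injective (hperm.eq_of_sortedLE (hS.monotone_row _).sortedLE_ofFn
    (hT.monotone_row _).sortedLE_ofFn)
  obtain ⟨j, hj⟩ := exists_rowBox_eq c
  simpa only [Function.comp_apply, hj] using congrFun hrow j

end ExponentWeight

section Independence

variable {μ : YoungDiagram} {m : ℕ}

theorem coeff_genericTableau {R V : Type*} [CommRing R] [AddCommGroup V] [Module R V]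
    {S T : Box μ → Fin m} (hS : IsSemistandard S) (hT : IsSemistandard T)
    (hle : rowWeight S ≤ rowWeight T) (b : Module.Basis (Fin m) R V) :
    MvPolynomial.coeff (colExponent 1 T) (genericTableau μ b (b ∘ S)) =
      if S = T then 1 else 0 := by
  have hone (σ : ColPerm μ) (h : colExponent σ S = colExponent 1 T) : σ = 1 :=
    eq_one_of_expWeight_eq hS (le_antisymm (expWeight_colExponent_le hS σ)
      (by rwa [h, expWeight_colExponent_one]))
  rw [genericTableau_comp, MvPolynomial.coeff_sum, Fintype.sum_eq_single 1 fun σ h => by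
    rw [MvPolynomial.coeff_monomial, if_neg fun h' => h (hone σ h')], MvPolynomial.coeff_monomial]
  obtain rfl | hST := eq_or_ne S T
  · simp
  · rw [if_neg hST, if_neg fun h => hST (eq_of_colExponent_one_eq hS hT h)]

variable {V : Type u} [AddCommGroup V] [Module ℝ V]

theorem linearIndependent_semistandard (b : Module.Basis (Fin m) ℝ V) :
    LinearIndependent ℝ fun T : {T : Box μ → Fin m // IsSemistandard T} =>
      schurH μ V (b ∘ T.1) := by
  refine LinearIndependent.of_comp (schurLift _ (exchangeAxioms_genericTableau b)) ?_
  have := Fintype.ofFinite {T : Box μ → Fin m // IsSemistandard T}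
  rw [Fintype.linearIndependent_iff]
  intro a ha
  by_contra! hne
  obtain ⟨T₀, hT₀⟩ := hne
  obtain ⟨T, hT, hmax⟩ := Finset.exists_max_image (Finset.univ.filter fun T => a T ≠ 0)
    (fun T => rowWeight T.1) ⟨T₀, by simpa using hT₀⟩
  simp only [Finset.mem_filter, Finset.mem_univ, true_and] at hT hmax
  have hcoeff (S : {T : Box μ → Fin m // IsSemistandard T}) (hS : a S ≠ 0) :
      MvPolynomial.coeff (colExponent 1 T.1) (genericTableau μ b fun c => b (S.1 c)) =
        if S.1 = T.1 then 1 else 0 :=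
    coeff_genericTableau S.2 T.2 (hmax S hS) b
  have h := congrArg (MvPolynomial.coeff (colExponent 1 T.1)) ha
  simp only [Function.comp_def, schurLift_schurH, MvPolynomial.coeff_sum,
    MvPolynomial.coeff_smul] at h
  rw [Fintype.sum_eq_single T fun S hST => ?_, hcoeff T hT] at h
  · exact hT (by simpa using h)
  · by_cases hS : a S = 0
    · rw [hS, zero_smul]
    · rw [hcoeff S hS, if_neg fun h => hST (Subtype.ext h), smul_zero]

/-- The semistandard fillings with entries in `Fin m` correspond to the semistandard tableaux with
entries in `{1, …, m}`. The latter are encoded by functions on `ℕ × ℕ` that vanish outside `μ`. -/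
def semistandardEquiv (μ : YoungDiagram) (m : ℕ) :
    {T : Box μ → Fin m // IsSemistandard T} ≃
      {T : SemistandardYoungTableau μ | ∀ i j, (i, j) ∈ μ → T i j ∈ Finset.Icc 1 m} where
  toFun T := ⟨{
    entry i j := if h : (i, j) ∈ μ then (T.1 ⟨(i, j), (YoungDiagram.mem_cells _).2 h⟩ : ℕ) + 1
      else 0
    row_weak' {i j₁ j₂} hj h := by
      rw [dif_pos h, dif_pos (μ.up_left_mem le_rfl hj.le h)]
      exact Nat.succ_le_succ (Fin.le_def.1 (T.2.row ⟨(i, j₁), _⟩ ⟨(i, j₂), _⟩ rfl hj))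
    col_strict' {i₁ i₂ j} hi h := by
      have h₁ := YoungDiagram.mem_iff_lt_colLen.1 (μ.up_left_mem hi.le le_rfl h)
      rw [dif_pos h, dif_pos (μ.up_left_mem hi.le le_rfl h)]
      exact Nat.succ_lt_succ (Fin.lt_def.1 (T.2.col j (a := ⟨i₁, h₁⟩)
        (b := ⟨i₂, YoungDiagram.mem_iff_lt_colLen.1 h⟩) hi))
    zeros' h := dif_neg h }, fun i j h => by
      rw [← SemistandardYoungTableau.to_fun_eq_coe]
      simp only [dif_pos h, Finset.mem_Icc]
      exact ⟨Nat.succ_pos _, Fin.isLt _⟩⟩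
  invFun T := ⟨fun c => ⟨T.1 c.1.1 c.1.2 - 1, by
      have := Finset.mem_Icc.1 (T.2 c.1.1 c.1.2 ((YoungDiagram.mem_cells _).1 c.2))
      lia⟩, by
    refine ⟨fun c c' h₁ h₂ => Fin.le_def.2 ?_, fun j a b hab => Fin.lt_def.2 ?_⟩
    · have := T.1.row_weak h₂ ((YoungDiagram.mem_cells _).1 c'.2)
      dsimp only
      rw [h₁]
      exact Nat.sub_le_sub_right this 1
    · have hlt := T.1.col_strict (j := j) (Fin.lt_def.1 hab)
        ((YoungDiagram.mem_cells _).1 (colBox μ j b).2)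
      have hpos := Finset.mem_Icc.1 (T.2 a j ((YoungDiagram.mem_cells _).1 (colBox μ j a).2))
      change T.1 a j - 1 < T.1 b j - 1
      lia⟩
  left_inv T := by
    refine Subtype.ext (funext fun c => Fin.ext ?_)
    change (if h : (c.1.1, c.1.2) ∈ μ then
      (T.1 ⟨(c.1.1, c.1.2), (YoungDiagram.mem_cells _).2 h⟩ : ℕ) + 1 else 0) - 1 = _
    rw [dif_pos ((YoungDiagram.mem_cells _).1 c.2)]
    rfl
  right_inv T := by
    refine Subtype.ext (SemistandardYoungTableau.ext fun i j => ?_)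
    change (if h : (i, j) ∈ μ then (T.1 i j - 1) + 1 else 0) = T.1 i j
    split_ifs with h
    · exact Nat.sub_add_cancel (Finset.mem_Icc.1 (T.2 i j h)).1
    · exact (T.1.zeros h).symm

theorem finrank_schurModule (μ : YoungDiagram) (b : Module.Basis (Fin m) ℝ V) :
    Module.finrank ℝ (SchurModule μ V) =
      {T : SemistandardYoungTableau μ | ∀ i j, (i, j) ∈ μ → T i j ∈ Finset.Icc 1 m}.ncard := by
  have hspan : ⊤ ≤ Submodule.span ℝ (Set.range
      fun T : {T : Box μ → Fin m // IsSemistandard T} => schurH μ V (b ∘ T.1)) := by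
    rw [← span_semistandard_eq_top b.span_eq, Set.image_eq_range]
    rfl
  rw [Module.finrank_eq_nat_card_basis
    (Module.Basis.mk (linearIndependent_semistandard (μ := μ) b) hspan),
    Nat.card_congr (semistandardEquiv μ m)]
  rfl

end Independence

/-! ### Convex bodies -/

section ConvexBody

variable {μ : YoungDiagram} {V : Type u} [AddCommGroup V] [Module ℝ V] {P : Set V}

theorem affineSpan_schurSet (hμ : 0 < μ.card) (hP : affineSpan ℝ P = ⊤) :
    affineSpan ℝ (schurSet μ P) = ⊤ := by
  have hmem (v : Box μ → V) : schurH μ V v ∈ affineSpan ℝ (schurSet μ P) :=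
    multilinear_mem_of_mem_affineSpan (A := fun _ => P)
      (fun p hp => subset_affineSpan ℝ _ (schurH_mem μ fun c => ⟨p c, hp c⟩))
      fun c => hP ▸ AffineSubspace.mem_top ℝ V (v c)
  have hzero : (0 : SchurModule μ V) ∈ affineSpan ℝ (schurSet μ P) := by
    obtain ⟨c, hc⟩ := Finset.card_pos.1 hμ
    exact (schurH μ V).map_coord_zero (m := fun _ => 0) (i := ⟨c, hc⟩) rfl ▸ hmem _
  rw [← AffineSubspace.direction_eq_top_iff_of_nonempty ⟨0, hzero⟩, eq_top_iff,
    ← span_range_schurH (μ := μ), Submodule.span_le]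
  rintro _ ⟨v, rfl⟩
  simpa using AffineSubspace.vsub_mem_direction (hmem v) hzero

theorem finrank_vectorSpan_schurSet [FiniteDimensional ℝ V] (hμ : 0 < μ.card)
    (hP : affineSpan ℝ P = ⊤) :
    Module.finrank ℝ (vectorSpan ℝ (schurSet μ P)) =
      {T : SemistandardYoungTableau μ | ∀ i j, (i, j) ∈ μ →
        T i j ∈ Finset.Icc 1 (Module.finrank ℝ V)}.ncard := by
  rw [← direction_affineSpan, affineSpan_schurSet hμ hP, AffineSubspace.direction_top, finrank_top,
    finrank_schurModule μ (Module.finBasis ℝ V)]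

variable [FiniteDimensional ℝ V] [TopologicalSpace V] [IsModuleTopology ℝ V]

theorem IsConvexBody.affineSpan_eq_top (hP : IsConvexBody P) : affineSpan ℝ P = ⊤ := by
  have := IsModuleTopology.topologicalAddGroup ℝ V
  have := t2Space_of_isModuleTopology (R := ℝ) (E := V)
  exact (interior_nonempty_iff_affineSpan_eq_top hP.convex).1 hP.interior_nonempty

theorem isConvexBody_schurSet (hμ : 0 < μ.card) (hP : IsConvexBody P) :
    IsConvexBody (schurSet μ P) where
  isCompact := isCompact_schurSet hP.isCompact
  convex := convex_convexHull ℝ _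
  interior_nonempty := by
    have := IsModuleTopology.topologicalAddGroup ℝ (SchurModule μ V)
    have := t2Space_of_isModuleTopology (R := ℝ) (E := SchurModule μ V)
    exact (interior_nonempty_iff_affineSpan_eq_top (convex_convexHull ℝ _)).2
      (affineSpan_schurSet hμ hP.affineSpan_eq_top)

end ConvexBody

/-! ### Linear matrix inequalities -/

section SDR

variable {E : Type u} [AddCommGroup E] [Module ℝ E]

theorem isSDR_of_finite {n F : Type*} [Finite n] [AddCommGroup F] [Module ℝ F]
    [FiniteDimensional ℝ F] {A : Matrix n n ℝ} {B : E →ₗ[ℝ] Matrix n n ℝ}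
    {C : F →ₗ[ℝ] Matrix n n ℝ} (hA : A.IsSymm) (hB : ∀ x, (B x).IsSymm) (hC : ∀ y, (C y).IsSymm) :
    IsSDR {x | ∃ y, (A + B x + C y).PosSemidef} := by
  have := Fintype.ofFinite n
  let e := Fintype.equivFin n
  let r := (Matrix.reindexLinearEquiv ℝ ℝ e e).toLinearMap
  let φ := (Module.finBasis ℝ F).equivFun
  refine ⟨Fintype.card n, Module.finrank ℝ F, r A, r ∘ₗ B, r ∘ₗ C ∘ₗ φ.symm.toLinearMap,
    hA.submatrix _, fun x => (hB x).submatrix _, fun y => (hC _).submatrix _, ?_⟩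
  ext x
  refine φ.toEquiv.exists_congr fun y => ?_
  change _ ↔ ((A + B x + C (φ.symm (φ y))).submatrix e.symm e.symm).PosSemidef
  rw [φ.symm_apply_apply, Matrix.posSemidef_submatrix_equiv]

theorem isSpectrahedron_of_finite {n : Type*} [Finite n] {A : Matrix n n ℝ}
    {B : E →ₗ[ℝ] Matrix n n ℝ} (hA : A.IsSymm) (hB : ∀ x, (B x).IsSymm) :
    IsSpectrahedron {x | (A + B x).PosSemidef} := by
  have := Fintype.ofFinite n
  let e := Fintype.equivFin n
  refine ⟨Fintype.card n, A.submatrix e.symm e.symm,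
    (Matrix.reindexLinearEquiv ℝ ℝ e e).toLinearMap ∘ₗ B, hA.submatrix _,
    fun x => (hB x).submatrix _, Set.ext fun x => ?_⟩
  exact (Matrix.posSemidef_submatrix_equiv e.symm).symm

theorem posSemidef_fromBlocks_diagonal {n κ : Type*} [Finite n] [Finite κ] [DecidableEq κ]
    {Z : Matrix n n ℝ} {d : κ → ℝ} :
    (Matrix.fromBlocks Z 0 0 (Matrix.diagonal d)).PosSemidef ↔ Z.PosSemidef ∧ ∀ i, 0 ≤ d i := by
  have := Fintype.ofFinite n
  have := Fintype.ofFinite κ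
  constructor
  · intro h
    exact ⟨h.submatrix Sum.inl, Matrix.posSemidef_diagonal_iff.1 (h.submatrix Sum.inr)⟩
  · rintro ⟨hZ, hd⟩
    have hD := Matrix.posSemidef_diagonal_iff.2 hd
    refine .of_dotProduct_mulVec_nonneg (hZ.1.fromBlocks (by simp) hD.1) fun x => ?_
    rw [← Sum.elim_comp_inl_inr x, Matrix.fromBlocks_mulVec, Sum.elim_comp_inl_inr, star_trivial,
      ← Sum.elim_comp_inl_inr x, sumElim_dotProduct_sumElim]
    simpa using add_nonneg (hZ.dotProduct_mulVec_nonneg _) (hD.dotProduct_mulVec_nonneg _)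

theorem isSDR_of_affine {n κ F : Type*} [Finite n] [Finite κ] [AddCommGroup F] [Module ℝ F]
    [FiniteDimensional ℝ F] {Z : F →ₗ[ℝ] Matrix n n ℝ} (hZ : ∀ y, (Z y).IsSymm) (a : κ → ℝ)
    (β : E →ₗ[ℝ] κ → ℝ) (γ : F →ₗ[ℝ] κ → ℝ) :
    IsSDR {x | ∃ y, (Z y).PosSemidef ∧ ∀ i, 0 ≤ (a + β x + γ y) i} := by
  classical
  let B : E →ₗ[ℝ] Matrix (n ⊕ κ) (n ⊕ κ) ℝ :=
    { toFun x := Matrix.fromBlocks 0 0 0 (Matrix.diagonal (β x))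
      map_add' x y := by simp [Matrix.fromBlocks_add]
      map_smul' r x := by simp [Matrix.fromBlocks_smul] }
  let C : F →ₗ[ℝ] Matrix (n ⊕ κ) (n ⊕ κ) ℝ :=
    { toFun y := Matrix.fromBlocks (Z y) 0 0 (Matrix.diagonal (γ y))
      map_add' x y := by simp [Matrix.fromBlocks_add]
      map_smul' r x := by simp [Matrix.fromBlocks_smul] }
  have hsum (x : E) (y : F) : Matrix.fromBlocks 0 0 0 (Matrix.diagonal a) + B x + C y =
      Matrix.fromBlocks (Z y) 0 0 (Matrix.diagonal (a + β x + γ y)) := by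
    simp [B, C, Matrix.fromBlocks_add, Matrix.diagonal_add]
  have h := isSDR_of_finite (A := Matrix.fromBlocks 0 0 0 (Matrix.diagonal a)) (B := B) (C := C)
    (Matrix.isSymm_zero.fromBlocks rfl (Matrix.isSymm_diagonal _))
    (fun x => Matrix.isSymm_zero.fromBlocks rfl (Matrix.isSymm_diagonal _))
    (fun y => (hZ y).fromBlocks rfl (Matrix.isSymm_diagonal _))
  simpa only [hsum, posSemidef_fromBlocks_diagonal] using h

theorem isSDR_image [FiniteDimensional ℝ E] {n F : Type*} [Finite n] [AddCommGroup F] [Module ℝ F]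
    [FiniteDimensional ℝ F] {Z : F →ₗ[ℝ] Matrix n n ℝ} (hZ : ∀ y, (Z y).IsSymm)
    (t : F →ₗ[ℝ] ℝ) (r : ℝ) (L : F →ₗ[ℝ] E) :
    IsSDR (L '' {y | (Z y).PosSemidef ∧ t y ≤ r}) := by
  let b := Module.finBasis ℝ E
  let β : E →ₗ[ℝ] Option (Fin (Module.finrank ℝ E) × Bool) → ℝ := LinearMap.pi fun i =>
    i.elim 0 fun s => (bif s.2 then 1 else -1 : ℝ) • b.coord s.1
  have h := isSDR_of_affine hZ (fun i => i.elim r 0) β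
    (LinearMap.pi fun i => i.elim (-t) fun s => -(LinearMap.proj (some s) ∘ₗ β ∘ₗ L))
  convert h using 1
  ext x
  refine exists_congr fun y => ?_
  have hx : L y = x ↔ ∀ i, b.coord i (L y) = b.coord i x := b.ext_elem_iff
  rw [Set.mem_ofPred_eq, and_assoc, and_congr_right_iff, hx]
  intro _
  simp only [Pi.add_apply, Option.forall, Prod.forall, Bool.forall_bool, le_antisymm_iff, β]
  refine and_congr (by simp) (forall_congr' fun i => and_comm.trans (and_congr ?_ ?_)) <;> simp

end SDR

/-! ### Polars -/

section Polar

variable {E : Type u} [AddCommGroup E] [Module ℝ E]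

theorem convex_polar (Q : Set (Module.Dual ℝ E)) : Convex ℝ (polar Q) := by
  intro x hx y hy s t hs ht hst ℓ hℓ
  rw [map_add, map_smul, map_smul]
  exact convex_Ici (-1 : ℝ) (hx ℓ hℓ) (hy ℓ hℓ) hs ht hst

theorem exists_dual_lt [FiniteDimensional ℝ E] [TopologicalSpace E] [IsModuleTopology ℝ E]
    {C : Set E} (hC : Convex ℝ C) (hcl : IsClosed C) (h0 : (0 : E) ∈ C) {y : E} (hy : y ∉ C) :
    ∃ ℓ : Module.Dual ℝ E, ℓ y < -1 ∧ ∀ b ∈ C, -1 ≤ ℓ b := by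
  have := IsModuleTopology.topologicalAddGroup ℝ E
  have := t2Space_of_isModuleTopology (R := ℝ) (E := E)
  have := locallyConvexSpace_of_finiteDimensional (E := E)
  obtain ⟨f, t, hft, hb⟩ := geometric_hahn_banach_point_closed hC hcl hy
  have ht : 0 < -t := by simpa using hb 0 h0
  refine ⟨(-t)⁻¹ • f.toLinearMap, ?_, fun b hbC => ?_⟩
  · change (-t)⁻¹ * f y < -1
    rw [inv_mul_lt_iff₀ ht]
    linarith
  · change -1 ≤ (-t)⁻¹ * f b
    rw [le_inv_mul_iff₀ ht]
    linarith [hb b hbC]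

theorem polar_eq_convexHull_insert_zero [FiniteDimensional ℝ E] [TopologicalSpace E]
    [IsModuleTopology ℝ E] {s : Set E} (hs : IsCompact s) :
    polar {ℓ : Module.Dual ℝ E | ∀ y ∈ s, -1 ≤ ℓ y} = convexHull ℝ (insert 0 s) := by
  have := IsModuleTopology.topologicalAddGroup ℝ E
  have := t2Space_of_isModuleTopology (R := ℝ) (E := E)
  refine subset_antisymm (fun y hy => ?_)
    (convexHull_min (Set.insert_subset ?_ ?_) (convex_polar _))
  · by_contra hyC
    obtain ⟨ℓ, hℓy, hℓ⟩ := exists_dual_lt (convex_convexHull ℝ _)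
      (isCompact_convexHull (hs.insert 0)).isClosed
      (subset_convexHull ℝ _ (Set.mem_insert 0 s)) hyC
    exact hℓy.not_ge (hy ℓ fun z hz => hℓ z (subset_convexHull ℝ _ (Set.mem_insert_of_mem 0 hz)))
  · intro ℓ _
    simp
  · exact fun y hy ℓ hℓ => hℓ y hy

end Polar

/-! ### Polars of spectrahedra `1 + ℓ(H) ⪰ 0` -/

section Pencil

variable {E : Type u} [AddCommGroup E] [Module ℝ E] {n : Type*}

/-- The linear pencil `ℓ ↦ (ℓ (H i j))` of a matrix `H` of vectors. -/
def pencil (H : Matrix n n E) : Module.Dual ℝ E →ₗ[ℝ] Matrix n n ℝ where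
  toFun ℓ := H.map ℓ
  map_add' _ _ := rfl
  map_smul' _ _ := rfl

/-- The spectrahedron of functionals `ℓ` with `1 + ℓ(H) ⪰ 0`. -/
def pencilSet [DecidableEq n] (H : Matrix n n E) : Set (Module.Dual ℝ E) :=
  {ℓ | (1 + pencil H ℓ).PosSemidef}

/-- The linear map dual to `pencil H`: the pairing of real matrices with the matrix `H` of
vectors. -/
def matrixPairing [Fintype n] (H : Matrix n n E) : Matrix n n ℝ →ₗ[ℝ] E :=
  ∑ i, ∑ j, (Matrix.entryLinearMap ℝ ℝ i j).smulRight (H i j)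

variable {H : Matrix n n E}

theorem isSymm_pencil (hH : H.IsSymm) (ℓ : Module.Dual ℝ E) : (pencil H ℓ).IsSymm :=
  hH.map ℓ

section Trace

variable [Fintype n]

theorem matrixPairing_apply (Z : Matrix n n ℝ) :
    matrixPairing H Z = ∑ i, ∑ j, Z i j • H i j := by
  simp [matrixPairing]

theorem trace_mul_transpose_nonneg {A B : Matrix n n ℝ} (hA : A.PosSemidef) (hB : B.PosSemidef) :
    0 ≤ (A * B.transpose).trace := by
  rw [← Matrix.sum_hadamard_eq]
  simpa [dotProduct, Matrix.mulVec] using (hA.hadamard hB).dotProduct_mulVec_nonneg 1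

theorem trace_vecMulVec_mul_transpose (c : n → ℝ) (B : Matrix n n ℝ) :
    (Matrix.vecMulVec c c * B.transpose).trace = c ⬝ᵥ B.mulVec c := by
  rw [Matrix.vecMulVec_mul, Matrix.trace_vecMulVec, Matrix.vecMul_transpose]

theorem isCompact_setOf_dotProduct_self_eq_one : IsCompact {c : n → ℝ | c ⬝ᵥ c = 1} := by
  convert (PiLp.homeomorph 2 fun _ : n => ℝ).symm.isCompact_preimage.2
    (isCompact_sphere (0 : EuclideanSpace ℝ n) 1) using 1
  ext c
  change _ ↔ WithLp.toLp 2 c ∈ Metric.sphere 0 1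
  simp [EuclideanSpace.norm_eq, dotProduct, sq]

variable [DecidableEq n]

theorem trace_mul_transpose_one_add_pencil (Z : Matrix n n ℝ) (ℓ : Module.Dual ℝ E) :
    (Z * (1 + pencil H ℓ).transpose).trace = Z.trace + ℓ (matrixPairing H Z) := by
  rw [Matrix.transpose_add, Matrix.transpose_one, mul_add, mul_one, Matrix.trace_add,
    ← Matrix.sum_hadamard_eq]
  simp only [Matrix.hadamard_apply, matrixPairing_apply, map_sum, map_smul, smul_eq_mul]
  rfl

theorem mem_pencilSet_iff (hH : H.IsSymm) {ℓ : Module.Dual ℝ E} :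
    ℓ ∈ pencilSet H ↔ ∀ y ∈ (fun c => matrixPairing H (Matrix.vecMulVec c c)) '' {c | c ⬝ᵥ c = 1},
      -1 ≤ ℓ y := by
  have hform (c : n → ℝ) : c ⬝ᵥ (1 + pencil H ℓ).mulVec c =
      c ⬝ᵥ c + ℓ (matrixPairing H (Matrix.vecMulVec c c)) := by
    rw [← trace_vecMulVec_mul_transpose, trace_mul_transpose_one_add_pencil,
      Matrix.trace_vecMulVec]
  rw [Set.forall_mem_image]
  refine ⟨fun h c hc => ?_, fun h => .of_dotProduct_mulVec_nonneg
    (Matrix.isSymm_one.add (isSymm_pencil hH ℓ)) fun c => ?_⟩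
  · have := h.dotProduct_mulVec_nonneg c
    rw [star_trivial, hform, hc] at this
    linarith
  · rw [star_trivial]
    rcases eq_or_ne c 0 with rfl | hc
    · simp
    have hpos : 0 < c ⬝ᵥ c := Matrix.dotProduct_self_star_pos_iff.2 hc
    have hr : (√(c ⬝ᵥ c))⁻¹ * (√(c ⬝ᵥ c))⁻¹ = (c ⬝ᵥ c)⁻¹ := by
      rw [← mul_inv, Real.mul_self_sqrt hpos.le]
    set r := (√(c ⬝ᵥ c))⁻¹
    have hunit : (r • c) ⬝ᵥ (r • c) = 1 := by
      rw [smul_dotProduct, dotProduct_smul, smul_smul, hr, smul_eq_mul, inv_mul_cancel₀ hpos.ne']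
    have hℓ := h hunit
    rw [Matrix.smul_vecMulVec, Matrix.vecMulVec_smul, smul_smul, hr, map_smul, map_smul,
      smul_eq_mul, le_inv_mul_iff₀ hpos] at hℓ
    rw [hform]
    linarith

theorem polar_pencilSet [FiniteDimensional ℝ E] (hH : H.IsSymm) : polar (pencilSet H) =
    matrixPairing H '' {Z | Z.PosSemidef ∧ Z.trace ≤ 1} := by
  refine subset_antisymm ?_ ?_
  · let _ : TopologicalSpace E := moduleTopology ℝ E
    have : IsModuleTopology ℝ E := ⟨rfl⟩
    have := IsModuleTopology.topologicalAddGroup ℝ E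
    have hcont : Continuous fun c => matrixPairing H (Matrix.vecMulVec c c) := by
      simp only [matrixPairing_apply, Matrix.vecMulVec_apply]
      fun_prop
    have hset : pencilSet H = {ℓ | _} := Set.ext fun ℓ => mem_pencilSet_iff hH
    rw [hset, polar_eq_convexHull_insert_zero (isCompact_setOf_dotProduct_self_eq_one.image hcont)]
    refine convexHull_min (Set.insert_subset ⟨0, ⟨.zero, by simp⟩, map_zero _⟩ ?_) ?_
    · rintro _ ⟨c, hc, rfl⟩
      exact ⟨_, ⟨Matrix.posSemidef_vecMulVec_self_star c, hc.le⟩, rfl⟩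
    · refine Convex.linear_image (fun Z hZ Z' hZ' s t hs ht hst => ?_) _
      refine ⟨(hZ.1.smul hs).add (hZ'.1.smul ht), ?_⟩
      rw [Matrix.trace_add, Matrix.trace_smul, Matrix.trace_smul]
      exact convex_Iic (1 : ℝ) hZ.2 hZ'.2 hs ht hst
  · rintro _ ⟨Z, ⟨hZ, htr⟩, rfl⟩ ℓ hℓ
    have := trace_mul_transpose_nonneg hZ hℓ
    rw [trace_mul_transpose_one_add_pencil] at this
    linarith

end Trace

variable [Finite n] [DecidableEq n]

theorem isSpectrahedron_pencilSet (hH : H.IsSymm) : IsSpectrahedron (pencilSet H) :=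
  isSpectrahedron_of_finite Matrix.isSymm_one (isSymm_pencil hH)

theorem isSDR_polar_pencilSet [FiniteDimensional ℝ E] (hH : H.IsSymm) :
    IsSDR (polar (pencilSet H)) := by
  have := Fintype.ofFinite n
  rw [polar_pencilSet hH]
  let symm := selfAdjoint.submodule ℝ (Matrix n n ℝ)
  have h := isSDR_image (Z := symm.subtype) (fun Z => Z.2)
    (Matrix.traceLinearMap n ℝ ℝ ∘ₗ symm.subtype) 1 (matrixPairing H ∘ₗ symm.subtype)
  convert h using 1
  ext y
  constructor
  · rintro ⟨Z, hZ, rfl⟩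
    exact ⟨⟨Z, hZ.1.1⟩, hZ, rfl⟩
  · rintro ⟨Z, hZ, rfl⟩
    exact ⟨Z, hZ, rfl⟩

end Pencil

/-! ### Moment relaxations of a convex hull -/

section Relaxation

variable {X : Type*} [TopologicalSpace X] {E : Type u} [AddCommGroup E] [Module ℝ E]

section Functional

variable {Λ : C(X, ℝ) →ₗ[ℝ] ℝ}

theorem map_mul_self_pos (hΛ : StrictMono Λ) {a : C(X, ℝ)} (ha : a ≠ 0) : 0 < Λ (a * a) := by
  have hne : a * a ≠ 0 := fun h => ha <| ContinuousMap.ext fun x =>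
    mul_self_eq_zero.1 (DFunLike.congr_fun h x)
  have hpos : 0 < a * a := lt_of_le_of_ne (fun x => mul_self_nonneg (a x)) hne.symm
  simpa using hΛ hpos

theorem exists_basis_orthonormal (hΛ : StrictMono Λ) (S : Submodule ℝ C(X, ℝ))
    [FiniteDimensional ℝ S] : ∃ b : Module.Basis (Fin (Module.finrank ℝ S)) ℝ S,
      ∀ i j, Λ (b i * b j) = (1 : Matrix _ _ ℝ) i j := by
  let B : LinearMap.BilinForm ℝ S :=
    ((LinearMap.mul ℝ C(X, ℝ)).compr₂ Λ).compl₁₂ S.subtype S.subtype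
  have hB (a b : S) : B a b = Λ (a * b) := rfl
  obtain ⟨v, hv⟩ := LinearMap.BilinForm.exists_orthogonal_basis (B := B)
    ⟨fun a b => by simp [hB, mul_comm]⟩
  have hpos (i) : 0 < Λ (v i * v i) := map_mul_self_pos hΛ (by simpa using v.ne_zero i)
  refine ⟨v.isUnitSMul fun i => (inv_ne_zero (Real.sqrt_pos.2 (hpos i)).ne').isUnit,
    fun i j => ?_⟩
  rw [v.isUnitSMul_apply, v.isUnitSMul_apply, Submodule.coe_smul, Submodule.coe_smul,
    smul_mul_smul_comm, map_smul, smul_eq_mul]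
  rcases eq_or_ne i j with rfl | hij
  · rw [Matrix.one_apply_eq, ← mul_inv, Real.mul_self_sqrt (hpos i).le,
      inv_mul_cancel₀ (hpos i).ne']
  · rw [Matrix.one_apply_ne hij, show Λ (v i * v j) = 0 from LinearMap.isOrthoᵢ_def.1 hv i j hij,
      mul_zero]

variable (Λ) (φ : Module.Dual ℝ E →ₗ[ℝ] C(X, ℝ))

/-- The functionals `ℓ` such that `Λ ((1 + φ ℓ) * a * a) ≥ 0` for all `a` in the space `S` of test
functions. When `φ ℓ = ℓ ∘ h` for a map `h`, they relax the condition that `ℓ ≥ -1` on the range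
of `h`. -/
def squareCone (S : Submodule ℝ C(X, ℝ)) : Set (Module.Dual ℝ E) :=
  {ℓ | ∀ a ∈ S, 0 ≤ Λ ((1 + φ ℓ) * a * a)}

theorem antitone_squareCone : Antitone (squareCone Λ φ) :=
  fun _ _ hST _ hℓ a ha => hℓ a (hST ha)

variable [FiniteDimensional ℝ E]

/-- The vector-valued moment of `g`, described by its pairings with functionals. -/
noncomputable def moment (g : C(X, ℝ)) : E :=
  (Module.evalEquiv ℝ E).symm (Λ ∘ₗ LinearMap.mulRight ℝ g ∘ₗ φ)

variable {Λ φ}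

theorem dual_moment (g : C(X, ℝ)) (ℓ : Module.Dual ℝ E) : ℓ (moment Λ φ g) = Λ (φ ℓ * g) :=
  Module.apply_evalEquiv_symm_apply ..

theorem map_one_add_mul_mul (ℓ : Module.Dual ℝ E) (a b : C(X, ℝ)) :
    Λ ((1 + φ ℓ) * a * b) = Λ (a * b) + ℓ (moment Λ φ (a * b)) := by
  rw [dual_moment, ← map_add, mul_assoc, add_mul, one_mul]

theorem exists_squareCone_eq_pencilSet (hΛ : StrictMono Λ) (S : Submodule ℝ C(X, ℝ))
    [FiniteDimensional ℝ S] : ∃ H : Matrix (Fin (Module.finrank ℝ S)) (Fin (Module.finrank ℝ S)) E,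
      H.IsSymm ∧ squareCone Λ φ S = pencilSet H := by
  obtain ⟨b, hb⟩ := exists_basis_orthonormal hΛ S
  let H := Matrix.of fun i j => moment Λ φ (b i * b j : C(X, ℝ))
  have hH : H.IsSymm := Matrix.IsSymm.ext fun i j => by simp [H, mul_comm]
  have hentry (ℓ i j) : Λ ((1 + φ ℓ) * b i * b j) = (1 + pencil H ℓ) i j := by
    rw [map_one_add_mul_mul, hb]
    rfl
  have hform (ℓ : Module.Dual ℝ E) (c : Fin (Module.finrank ℝ S) → ℝ) :
      Λ ((1 + φ ℓ) * (∑ i, c i • b i : C(X, ℝ)) * (∑ i, c i • b i : C(X, ℝ))) =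
        c ⬝ᵥ (1 + pencil H ℓ).mulVec c := by
    simp only [dotProduct, Matrix.mulVec, ← hentry, Finset.mul_sum, Finset.sum_mul, map_sum,
      mul_smul_comm, smul_mul_assoc, map_smul, smul_eq_mul]
    rw [Finset.sum_comm]
    exact Finset.sum_congr rfl fun i _ => Finset.sum_congr rfl fun j _ => by ring
  refine ⟨H, hH, Set.ext fun ℓ => ⟨fun hℓ => .of_dotProduct_mulVec_nonneg
    (Matrix.isSymm_one.add (isSymm_pencil hH ℓ)) fun c => ?_, fun hℓ a ha => ?_⟩⟩
  · rw [star_trivial, ← hform]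
    exact hℓ _ (S.sum_mem fun i _ => S.smul_mem _ (b i).2)
  · have hsum := congrArg Subtype.val (b.sum_repr ⟨a, ha⟩)
    simp only [Submodule.coe_sum, Submodule.coe_smul] at hsum
    rw [← hsum, hform]
    simpa using hℓ.dotProduct_mulVec_nonneg (b.repr ⟨a, ha⟩)

theorem mem_squareCone_of_forall_polar (hΛ : StrictMono Λ) {S : Submodule ℝ C(X, ℝ)}
    {ℓ : Module.Dual ℝ E} (h : ∀ y ∈ polar (squareCone Λ φ S), -1 ≤ ℓ y) :
    ℓ ∈ squareCone Λ φ S := by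
  intro a ha
  rcases eq_or_ne a 0 with rfl | ha0
  · simp
  have hpos := map_mul_self_pos hΛ ha0
  have hpolar : (Λ (a * a))⁻¹ • moment Λ φ (a * a) ∈ polar (squareCone Λ φ S) := by
    intro ℓ' hℓ'
    have := hℓ' a ha
    rw [map_one_add_mul_mul] at this
    rw [map_smul, smul_eq_mul, le_inv_mul_iff₀ hpos]
    linarith
  have := h _ hpolar
  rw [map_smul, smul_eq_mul, le_inv_mul_iff₀ hpos] at this
  rw [map_one_add_mul_mul]
  linarith

end Functional

theorem nonneg_of_forall_map_mul_mul_self_nonneg [CompactSpace X] {Λ : C(X, ℝ) →L[ℝ] ℝ}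
    (hΛ : StrictMono Λ) {D : Set C(X, ℝ)} (hD : Dense D) {f : C(X, ℝ)}
    (hf : ∀ a ∈ D, 0 ≤ Λ (f * a * a)) : 0 ≤ f := by
  have hall (a : C(X, ℝ)) : 0 ≤ Λ (f * a * a) := by
    have hclosed : IsClosed {a : C(X, ℝ) | 0 ≤ Λ (f * a * a)} :=
      isClosed_le continuous_const (by fun_prop)
    exact hclosed.closure_subset_iff.2 hf (hD a)
  have hcube : f * f⁻ * f⁻ = -(f⁻ * f⁻ * f⁻) := by
    ext x
    rcases le_total (f x) 0 with hx | hx <;> simp [negPart_def, hx]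
  have hle : Λ (f⁻ * f⁻ * f⁻) ≤ 0 := by simpa [hcube] using hall f⁻
  have hzero : f⁻ * f⁻ * f⁻ = 0 := by
    by_contra hne
    have hnonneg : 0 ≤ f⁻ * f⁻ * f⁻ := fun x =>
      mul_nonneg (mul_self_nonneg _) (negPart_nonneg f x)
    refine hle.not_gt ?_
    simpa using hΛ (lt_of_le_of_ne hnonneg (Ne.symm hne))
  refine negPart_eq_zero.1 (ContinuousMap.ext fun x => ?_)
  have hx := DFunLike.congr_fun hzero x
  simpa using hx

/-- A continuous map into a vector space, acting on functionals by composition. -/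
def dualPullback [TopologicalSpace E] [IsModuleTopology ℝ E] (h : C(X, E)) :
    Module.Dual ℝ E →ₗ[ℝ] C(X, ℝ) where
  toFun ℓ := ⟨ℓ ∘ h, (IsModuleTopology.continuous_of_linearMap ℓ).comp h.continuous⟩
  map_add' _ _ := rfl
  map_smul' _ _ := rfl

theorem convexHull_range_eq_closure_iUnion_polar [CompactSpace X] [FiniteDimensional ℝ E]
    [TopologicalSpace E] [IsModuleTopology ℝ E] {Λ : C(X, ℝ) →L[ℝ] ℝ} (hΛ : StrictMono Λ)
    {h : C(X, E)} (h0 : 0 ∈ convexHull ℝ (Set.range h)) {S : ℕ → Submodule ℝ C(X, ℝ)}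
    (hS : Monotone S) (hdense : Dense (⋃ k, (S k : Set C(X, ℝ)))) :
    convexHull ℝ (Set.range h) =
      closure (⋃ k, polar (squareCone (Λ : C(X, ℝ) →ₗ[ℝ] ℝ) (dualPullback h) (S k))) := by
  have := IsModuleTopology.topologicalAddGroup ℝ E
  have := t2Space_of_isModuleTopology (R := ℝ) (E := E)
  have hcl := (isCompact_convexHull (isCompact_range h.continuous)).isClosed
  have hmono : Monotone fun k => polar (squareCone (Λ : C(X, ℝ) →ₗ[ℝ] ℝ) (dualPullback h) (S k)) :=
    fun k l hkl y hy ℓ hℓ => hy ℓ (antitone_squareCone _ _ (hS hkl) hℓ)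
  have hconv := (hmono.directed_le.convex_iUnion fun k => convex_polar _).closure
  refine Set.Subset.antisymm (convexHull_min ?_ hconv)
    (closure_minimal (Set.iUnion_subset fun k y hy => ?_) hcl)
  · rintro _ ⟨x, rfl⟩
    by_contra hx
    obtain ⟨ℓ, hℓx, hℓ⟩ := exists_dual_lt hconv isClosed_closure
      (subset_closure (Set.mem_iUnion.2 ⟨0, fun ℓ _ => by simp⟩)) hx
    have hcone (k) : ℓ ∈ squareCone (Λ : C(X, ℝ) →ₗ[ℝ] ℝ) (dualPullback h) (S k) :=
      mem_squareCone_of_forall_polar hΛ fun y hy =>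
        hℓ y (subset_closure (Set.mem_iUnion.2 ⟨k, hy⟩))
    have hnonneg : 0 ≤ 1 + dualPullback h ℓ :=
      nonneg_of_forall_map_mul_mul_self_nonneg hΛ hdense fun a ha => by
        obtain ⟨k, hk⟩ := Set.mem_iUnion.1 ha
        exact hcone k a hk
    have : 0 ≤ 1 + ℓ (h x) := hnonneg x
    linarith
  · by_contra hyC
    obtain ⟨ℓ, hℓy, hℓ⟩ := exists_dual_lt (convex_convexHull ℝ _) hcl h0 hyC
    refine hℓy.not_ge (hy ℓ fun a _ => ?_)
    have hnonneg : 0 ≤ (1 + dualPullback h ℓ) * a * a := fun x => by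
      have hx : -1 ≤ ℓ (h x) := hℓ _ (subset_convexHull ℝ _ ⟨x, rfl⟩)
      change 0 ≤ (1 + ℓ (h x)) * a x * a x
      rw [mul_assoc]
      exact mul_nonneg (by linarith) (mul_self_nonneg _)
    simpa using hΛ.monotone hnonneg

end Relaxation

/-! ### The approximation scheme of a measure -/

section Integral

variable {X : Type*} [TopologicalSpace X] [CompactSpace X] [MeasurableSpace X]
  [OpensMeasurableSpace X]

theorem integrable_continuousMap (m : Measure X) [IsFiniteMeasureOnCompacts m] (f : C(X, ℝ)) :
    Integrable f m :=
  f.continuous.integrable_of_hasCompactSupport (.of_compactSpace f)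

/-- Integration against a finite measure, as a continuous functional on continuous functions. -/
noncomputable def integralFunctional (m : Measure X) [IsFiniteMeasure m] : C(X, ℝ) →L[ℝ] ℝ :=
  LinearMap.mkContinuous
    { toFun f := ∫ x, f x ∂m
      map_add' f g := integral_add (integrable_continuousMap m f) (integrable_continuousMap m g)
      map_smul' c f := integral_const_mul c f }
    (m.real Set.univ) fun f => by
      rw [mul_comm]
      exact norm_integral_le_of_norm_le_const (.of_forall f.norm_coe_le_norm)

theorem strictMono_integralFunctional (m : Measure X) [IsFiniteMeasure m] [m.IsOpenPosMeasure] :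
    StrictMono (integralFunctional m) := by
  intro f g hfg
  obtain ⟨x, hx⟩ := DFunLike.ne_iff.1 (sub_ne_zero.2 hfg.ne')
  rw [← sub_pos, ← map_sub]
  exact (g - f).continuous.integral_pos_of_hasCompactSupport_nonneg_nonzero (.of_compactSpace _)
    (fun y => sub_nonneg.2 (hfg.le y)) hx

end Integral

theorem isSupportedOn_pi {ι : Type*} [Fintype ι] {V : ι → Type*} [∀ i, TopologicalSpace (V i)]
    [∀ i, MeasurableSpace (V i)] {ν : ∀ i, Measure (V i)} {P : ∀ i, Set (V i)}
    (hν : ∀ i, IsSupportedOn (ν i) (P i)) :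
    IsSupportedOn (Measure.pi ν) (Set.univ.pi P) := by
  have hfinite (i : ι) : IsFiniteMeasure (ν i) := (hν i).finite
  refine ⟨inferInstance, ?_, fun x hx U hU => ?_⟩
  · have hae : ∀ᵐ y ∂Measure.pi ν, ∀ i, y i ∈ P i :=
      ae_all_iff.2 fun i => Measure.pi_eval_preimage_null ν (hν i).compl_eq_zero
    exact mem_ae_iff.1 (hae.mono fun y hy i _ => hy i)
  · rw [nhds_pi, Filter.mem_pi] at hU
    obtain ⟨I, -, t, ht, hsub⟩ := hU
    have hpos : 0 < Measure.pi ν (Set.univ.pi t) := by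
      rw [Measure.pi_pi, pos_iff_ne_zero, Finset.prod_ne_zero_iff]
      exact fun i _ => ((hν i).pos _ (hx i trivial) _ (ht i)).ne'
    exact hpos.trans_le (measure_mono ((Set.pi_mono' (fun _ _ => subset_rfl) I.subset_univ).trans
      hsub))

theorem IsSupportedOn.isOpenPosMeasure_comap {V : Type*} [TopologicalSpace V] [MeasurableSpace V]
    {m : Measure V} {P : Set V} (hm : IsSupportedOn m P) (hP : MeasurableSet P) :
    (m.comap (Subtype.val : P → V)).IsOpenPosMeasure where
  open_pos U hU hne := by
    obtain ⟨O, hO, rfl⟩ := isOpen_induced_iff.1 hU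
    obtain ⟨x, hx⟩ := hne
    rw [comap_subtype_coe_apply hP, Subtype.image_preimage_coe, Set.inter_comm,
      measure_inter_conull hm.compl_eq_zero]
    exact (hm.pos x x.2 O (hO.mem_nhds hx)).ne'

section Haar

variable {V : Type*} [AddCommGroup V] [Module ℝ V] [FiniteDimensional ℝ V] [TopologicalSpace V]
  [IsModuleTopology ℝ V] [MeasurableSpace V] [BorelSpace V]

theorem isSupportedOn_restrict {P : Set V} (hP : IsConvexBody P) (vol : Measure V)
    [vol.IsAddHaarMeasure] : IsSupportedOn (vol.restrict P) P := by
  have := IsModuleTopology.topologicalAddGroup ℝ V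
  have := t2Space_of_isModuleTopology (R := ℝ) (E := V)
  have hmeas : MeasurableSet P := hP.isCompact.measurableSet
  refine ⟨⟨by simpa using hP.isCompact.measure_lt_top⟩, by simp [hmeas], fun x hx U hU => ?_⟩
  rw [Measure.restrict_apply' hmeas]
  have hcl : x ∈ closure (interior P) := by
    rw [hP.convex.closure_interior_eq_closure_of_nonempty_interior hP.interior_nonempty]
    exact subset_closure hx
  have hne : (interior U ∩ interior P).Nonempty :=
    mem_closure_iff_nhds.1 hcl _ (interior_mem_nhds.2 hU)
  exact ((isOpen_interior.inter isOpen_interior).measure_pos vol hne).trans_le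
    (measure_mono (Set.inter_subset_inter interior_subset interior_subset))

theorem secondCountableTopology_of_finiteDimensional (V : Type*) [AddCommGroup V] [Module ℝ V]
    [FiniteDimensional ℝ V] [TopologicalSpace V] [IsModuleTopology ℝ V] :
    SecondCountableTopology V := by
  have := IsModuleTopology.topologicalAddGroup ℝ V
  have := t2Space_of_isModuleTopology (R := ℝ) (E := V)
  exact (toEuclidean (E := V)).toHomeomorph.secondCountableTopology

end Haar

section Scheme

variable {μ : YoungDiagram} {V : Type u} [AddCommGroup V] [Module ℝ V] [FiniteDimensional ℝ V]
  [TopologicalSpace V] [IsModuleTopology ℝ V]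

variable (μ) in
/-- The set `P × ⋯ × P` of fillings of the boxes by points of `P`. -/
abbrev boxPower (P : Set V) : Set (Box μ → V) := Set.univ.pi fun _ => P

variable (μ) in
/-- The polynomials in the coordinates of the vectors in the boxes, as continuous functions on a
set `K` of fillings. -/
noncomputable def boxPoly (K : Set (Box μ → V)) :
    MvPolynomial (Box μ × Fin (Module.finrank ℝ V)) ℝ →ₐ[ℝ] C(K, ℝ) :=
  MvPolynomial.aeval fun t =>
    ⟨fun x => (Module.finBasis ℝ V).repr (x.1 t.1) t.2,
      (IsModuleTopology.continuous_of_linearMap ((Module.finBasis ℝ V).coord t.2)).comp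
        ((continuous_apply t.1).comp continuous_subtype_val)⟩

theorem boxPoly_apply {K : Set (Box μ → V)}
    (a : MvPolynomial (Box μ × Fin (Module.finrank ℝ V)) ℝ) (x : K) :
    boxPoly μ K a x = evalPoly μ a x := by
  refine (MvPolynomial.comp_aeval_apply _ (ContinuousMap.evalAlgHom ℝ ℝ x) a).trans ?_
  rw [MvPolynomial.aeval_eq_eval]
  rfl

theorem separatesPoints_range_boxPoly (K : Set (Box μ → V)) :
    (boxPoly μ K).range.SeparatesPoints := by
  intro x y hxy
  obtain ⟨c, hc⟩ := Function.ne_iff.1 (Subtype.coe_injective.ne hxy)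
  obtain ⟨i, hi⟩ := DFunLike.ne_iff.1 ((Module.finBasis ℝ V).repr.injective.ne hc)
  exact ⟨_, ⟨_, ⟨MvPolynomial.X (c, i), rfl⟩, rfl⟩, by simpa [boxPoly_apply, evalPoly] using hi⟩

variable (μ) in
/-- The polynomials of degree at most `k`, as continuous functions on a set `K` of fillings. -/
noncomputable def boxPolyOfDegreeLE (K : Set (Box μ → V)) (k : ℕ) : Submodule ℝ C(K, ℝ) :=
  (MvPolynomial.restrictTotalDegree _ ℝ k).map (boxPoly μ K).toLinearMap

instance finiteDimensional_boxPolyOfDegreeLE (K : Set (Box μ → V)) (k : ℕ) :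
    FiniteDimensional ℝ (boxPolyOfDegreeLE μ K k) :=
  Module.Finite.map _ _

theorem monotone_boxPolyOfDegreeLE (K : Set (Box μ → V)) : Monotone (boxPolyOfDegreeLE μ K) :=
  fun k l hkl => Submodule.map_mono fun a ha => by
    rw [MvPolynomial.mem_restrictTotalDegree] at ha ⊢
    exact ha.trans hkl

theorem dense_iUnion_boxPolyOfDegreeLE {K : Set (Box μ → V)} (hK : IsCompact K) :
    Dense (⋃ k, (boxPolyOfDegreeLE μ K k : Set C(K, ℝ))) := by
  have : CompactSpace K := isCompact_iff_compactSpace.1 hK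
  have htop := ContinuousMap.subalgebra_topologicalClosure_eq_top_of_separatesPoints _
    (separatesPoints_range_boxPoly K)
  refine (dense_iff_closure_eq.2 (congrArg SetLike.coe htop)).mono ?_
  rintro _ ⟨a, rfl⟩
  exact Set.mem_iUnion.2 ⟨_, a, (MvPolynomial.mem_restrictTotalDegree _ _ _).2 le_rfl, rfl⟩

variable (μ) in
/-- The universal map `h_μ`, as a continuous map on a set `K` of fillings. -/
noncomputable def continuousSchurH (K : Set (Box μ → V)) : C(K, SchurModule μ V) :=
  have := IsModuleTopology.topologicalAddGroup ℝ (SchurModule μ V)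
  ⟨fun x => schurH μ V x, (continuous_multilinearMap (schurH μ V)).comp continuous_subtype_val⟩

theorem schurSet_eq_convexHull_range (P : Set V) :
    schurSet μ P =
      convexHull ℝ (Set.range (continuousSchurH μ (boxPower μ P))) := by
  rw [schurSet, Set.image_eq_range]
  rfl

variable [MeasurableSpace V] {P : Set V} {ν : Measure V}

variable (μ P ν) in
/-- The product of copies of `ν`, as a measure on the fillings by points of `P`. -/
noncomputable abbrev boxMeasure : Measure (boxPower μ P) :=
  (Measure.pi fun _ => ν).comap Subtype.val

theorem momentForm_eq_integral_boxMeasure (hK : MeasurableSet (boxPower μ P))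
    (ℓ : Module.Dual ℝ (SchurModule μ V))
    (a b : MvPolynomial (Box μ × Fin (Module.finrank ℝ V)) ℝ) :
    momentForm μ P ν ℓ a b =
      ∫ x, ((1 + dualPullback (continuousSchurH μ _) ℓ) * boxPoly μ _ a * boxPoly μ _ b :
        C(boxPower μ P, ℝ)) x ∂boxMeasure μ P ν := by
  simp only [ContinuousMap.mul_apply, boxPoly_apply]
  exact (integral_subtype_comap hK fun x =>
    (1 + ℓ (schurH μ V x)) * evalPoly μ a x * evalPoly μ b x).symm

theorem schemeQ_eq_squareCone [CompactSpace (boxPower μ P)]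
    [OpensMeasurableSpace (boxPower μ P)] [IsFiniteMeasure ν]
    (hK : MeasurableSet (boxPower μ P)) (k : ℕ) :
    schemeQ μ P ν k =
      squareCone (integralFunctional (boxMeasure μ P ν) : C(boxPower μ P, ℝ) →ₗ[ℝ] ℝ)
        (dualPullback (continuousSchurH μ (boxPower μ P))) (boxPolyOfDegreeLE μ _ k) := by
  ext ℓ
  simp only [schemeQ, squareCone, boxPolyOfDegreeLE, Submodule.mem_map, forall_exists_index,
    and_imp, forall_apply_eq_imp_iff₂, MvPolynomial.mem_restrictTotalDegree,
    momentForm_eq_integral_boxMeasure hK]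
  rfl

theorem isAccurateScheme [BorelSpace V] (hμ : 0 < μ.card) (hP : IsCompact P) (h0 : 0 ∈ P)
    (hν : IsSupportedOn ν P) : IsAccurateScheme μ P ν := by
  have := IsModuleTopology.topologicalAddGroup ℝ V
  have := t2Space_of_isModuleTopology (R := ℝ) (E := V)
  have := secondCountableTopology_of_finiteDimensional V
  have hK : IsCompact (boxPower μ P) := isCompact_univ_pi fun _ => hP
  have : CompactSpace (boxPower μ P) := isCompact_iff_compactSpace.1 hK
  have := hν.finite
  have : (boxMeasure μ P ν).IsOpenPosMeasure :=
    (isSupportedOn_pi fun _ => hν).isOpenPosMeasure_comap hK.measurableSet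
  have hΛ := strictMono_integralFunctional (boxMeasure μ P ν)
  have hQ : schemeQ μ P ν = _ := funext (schemeQ_eq_squareCone hK.measurableSet)
  have hpencil (k) := exists_squareCone_eq_pencilSet
    (φ := dualPullback (continuousSchurH μ (boxPower μ P))) hΛ (boxPolyOfDegreeLE μ _ k)
  simp only [← schemeQ_eq_squareCone hK.measurableSet] at hpencil
  choose H hH hpencil using hpencil
  refine ⟨?_, fun k => ?_, fun k => ?_, ?_⟩
  · rw [hQ]
    exact (antitone_squareCone _ _).comp_monotone (monotone_boxPolyOfDegreeLE _)
  · rw [hpencil]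
    exact isSpectrahedron_pencilSet (hH k)
  · rw [hpencil]
    exact isSDR_polar_pencilSet (hH k)
  · rw [hQ, schurSet_eq_convexHull_range]
    exact convexHull_range_eq_closure_iUnion_polar hΛ
      (schurSet_eq_convexHull_range P ▸ zero_mem_schurSet hμ h0) (monotone_boxPolyOfDegreeLE _)
      (dense_iUnion_boxPolyOfDegreeLE hK)

end Scheme

end ConvexSchur

theorem mainTheorem8_general (μ : YoungDiagram) (hμ : 0 < μ.card) :
    (∃ (hS : ∀ P : CompactConvex.{u}, IsCompactConvexZero (schurSet μ P.carrier))
        (F : CompactConvex.{u} ⥤ CompactConvex.{u})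
        (hobj : ∀ P, F.obj P = P.schurObj μ (hS P)),
        ∀ (P Q : CompactConvex.{u}) (f : P ⟶ Q) (L : P.space →ₗ[ℝ] Q.space),
          CompactConvex.IsRestrictionOf f L →
          CompactConvex.IsRestrictionOf
            (eqToHom (hobj P).symm ≫ F.map f ≫ eqToHom (hobj Q)) (schurMap μ L)) ∧
    (∀ (V : Type v) [AddCommGroup V] [Module ℝ V] (P : Set V),
      (Convex ℝ P → ∀ (E : Type w) [AddCommGroup E] [Module ℝ E] (W : Set E), Convex ℝ W →
        ∀ T : (Box μ → P) → W,
        (∃ M : MultilinearMap ℝ (fun _ : Box μ => V) E, ∀ p, (T p : E) = M fun c => (p c : V)) →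
        ExchangeAxioms μ (fun p => (T p : E)) →
        ∃! t : schurSet μ P → W, IsLinearRestriction t ∧
          ∀ p : Box μ → P, t ⟨schurH μ V (fun c => (p c : V)), schurH_mem μ p⟩ = T p) ∧
      (1 < μ.colLen 0 → ∀ x ∈ schurSet μ P, -x ∈ schurSet μ P) ∧
      (IsPolytope P → IsPolytope (schurSet μ P))) ∧
    ∀ (V : Type v) [AddCommGroup V] [Module ℝ V] [FiniteDimensional ℝ V]
      [TopologicalSpace V] [IsModuleTopology ℝ V] (P : Set V),
      (IsConvexBody P →
        IsConvexBody (schurSet μ P) ∧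
        Module.finrank ℝ (vectorSpan ℝ (schurSet μ P)) =
          {T : SemistandardYoungTableau μ | ∀ i j, (i, j) ∈ μ →
            T i j ∈ Finset.Icc 1 (Module.finrank ℝ V)}.ncard) ∧
      (IsCompact P → Convex ℝ P →
        schurSet μ P = convexHull ℝ (schurH μ V '' Set.univ.pi fun _ => P.extremePoints ℝ)) ∧
      ∀ [MeasurableSpace V] [BorelSpace V],
        (IsCompact P → 0 ∈ P → ∀ ν : Measure V, IsSupportedOn ν P → IsAccurateScheme μ P ν) ∧
        (IsConvexBody P → ∀ vol : Measure V, vol.IsAddHaarMeasure →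
          IsSupportedOn (vol.restrict P) P) := by
  refine ⟨⟨CompactConvex.isCompactConvexZero_schurSet hμ, CompactConvex.schurFunctor hμ,
    fun _ => rfl, fun _ _ _ _ => CompactConvex.schurFunctor_map_isRestrictionOf hμ⟩,
    fun V _ _ P => ⟨fun hP E _ _ W hW => existsUnique_linearization hP hW,
      fun h x => neg_mem_schurSet h, isPolytope_schurSet⟩,
    fun V _ _ _ _ _ P => ⟨fun hP => ⟨isConvexBody_schurSet hμ hP,
      finrank_vectorSpan_schurSet hμ hP.affineSpan_eq_top⟩,
      fun hP hconv => (schurSet_extremePoints hP hconv).symm, ?_⟩⟩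
  exact ⟨fun hP h0 ν => isAccurateScheme hμ hP h0, fun hP vol _ => isSupportedOn_restrict hP vol⟩

theorem mainTheorem8 (μ : YoungDiagram) (hμ : 0 < μ.card) :
    -- `𝕊_μ` is a functor on compact convex sets containing the origin
    (∃ (hS : ∀ P : CompactConvex.{u}, IsCompactConvexZero (schurSet μ P.carrier))
        (F : CompactConvex.{u} ⥤ CompactConvex.{u})
        (hobj : ∀ P, F.obj P = P.schurObj μ (hS P)),
        ∀ (P Q : CompactConvex.{u}) (f : P ⟶ Q) (L : P.space →ₗ[ℝ] Q.space),
          CompactConvex.IsRestrictionOf f L →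
          CompactConvex.IsRestrictionOf
            (eqToHom (hobj P).symm ≫ F.map f ≫ eqToHom (hobj Q)) (schurMap μ L)) ∧
    ∀ (V : Type u) [AddCommGroup V] [Module ℝ V] [FiniteDimensional ℝ V]
      [TopologicalSpace V] [IsModuleTopology ℝ V] [MeasurableSpace V] [BorelSpace V]
      (P : Set V), IsCompactConvexZero P →
      -- linearization of multilinear maps satisfying the exchange axioms
      (∀ (E : Type w) [AddCommGroup E] [Module ℝ E] [FiniteDimensional ℝ E]
        [TopologicalSpace E] [IsModuleTopology ℝ E] (W : Set E),
        IsCompact W → Convex ℝ W → ∀ T : (Box μ → P) → W,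
        (∃ M : MultilinearMap ℝ (fun _ : Box μ => V) E, ∀ p, (T p : E) = M fun c => (p c : V)) →
        ExchangeAxioms μ (fun p => (T p : E)) →
        ∃! t : schurSet μ P → W, IsLinearRestriction t ∧
          ∀ p : Box μ → P, t ⟨schurH μ V (fun c => (p c : V)), schurH_mem μ p⟩ = T p) ∧
      -- convex body, dimension, central symmetry
      (IsConvexBody P →
        IsConvexBody (schurSet μ P) ∧
        Module.finrank ℝ (vectorSpan ℝ (schurSet μ P)) =
          {T : SemistandardYoungTableau μ | ∀ i j, (i, j) ∈ μ →
            T i j ∈ Finset.Icc 1 (Module.finrank ℝ V)}.ncard) ∧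
      (1 < μ.colLen 0 → ∀ x ∈ schurSet μ P, -x ∈ schurSet μ P) ∧
      -- extreme points and polytopes
      schurSet μ P = convexHull ℝ (schurH μ V '' Set.univ.pi fun _ => P.extremePoints ℝ) ∧
      (IsPolytope P → IsPolytope (schurSet μ P)) ∧
      -- approximation by projections of spectrahedra
      (∀ ν : Measure V, IsSupportedOn ν P → IsAccurateScheme μ P ν) ∧
      (IsConvexBody P → ∀ vol : Measure V, vol.IsAddHaarMeasure →
        IsSupportedOn (vol.restrict P) P) := by
  obtain ⟨hfunctor, hconvex, htop⟩ := mainTheorem8_general.{u, u, w} μ hμ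
  refine ⟨hfunctor, fun V _ _ _ _ _ _ _ P hP => ?_⟩
  obtain ⟨hlin, hneg, hpoly⟩ := hconvex V P
  obtain ⟨hbody, hextreme, hmeasure⟩ := htop V P
  exact ⟨fun E _ _ _ _ _ W _ => hlin hP.convex E W, hbody, hneg, hextreme hP.isCompact hP.convex,
    hpoly, hmeasure.1 hP.isCompact hP.zero_mem, hmeasure.2⟩
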